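/- **Homogeneous perfect sets.** Let $J_\emptyset=[0,1]$, let $n_k\ge 2$ be integers, $0<c_k<1$ and $\eta_{k,j}\ge 0$ ($k\ge1$, $0\le j\le n_k$) reals. Let $\Omega_k$ be the set of words $\sigma=(\sigma_1,\dots,\sigma_k)$ with $1\le\sigma_j\le n_j$. Closed intervals $J_\sigma\subseteq[0,1]$ ($\sigma\in\Omega_k$, $k\ge 0$) have the homogeneous perfect structure if for all $k\ge0$, $\sigma\in\Omega_{k}$: the intervals $J_{\sigma*1},\dots,J_{\sigma*n_{k+1}}$ lie in $J_\sigma$, from left to right with disjoint interiors; $|J_{\sigma*i}|=c_{k+1}|J_\sigma|$; and the gaps in $J_\sigma$ before $J_{\sigma*1}$, between $J_{\sigma*i}$ and $J_{\sigma*(i+1)}$, and after $J_{\sigma*n_{k+1}}$ have lengths $\eta_{k+1,0}$, $\eta_{k+1,i}$ and $\eta_{k+1,n_{k+1}}$. Then $E=\bigcap_{k}\bigcup_{\sigma\in\Omega_k}J_\sigma$ is called a homogeneous perfect set. **Reconstruction.** Let $J^*_\sigma$ ($\sigma\in\Omega_k$) be $J_\sigma$ without its leftmost gap (length $\eta_{k+1,0}$)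 and its rightmost gap (length $\eta_{k+1,n_{k+1}}$). Let $2^{i_k}\le n_k<2^{i_k+1}$, $m_0=0$, $m_k=i_1+\dots+i_k$. The family $\mathcal F_{m_k}$ consists of the $J^*_\sigma$, $\sigma\in\Omega_k$. For $1\le t<i_{k+1}$ the family $\mathcal F_{m_k+t}$ is obtained by halving, $t$ times, each block of consecutive intervals $J^*_{\sigma*1},\dots,J^*_{\sigma*n_{k+1}}$ ($\sigma\in\Omega_k$): a block of $s$ intervals is split into its first $\lfloor s/2\rfloor$ and its last $\lceil s/2\rceil$ intervals. Each resulting block gives one element of $\mathcal F_{m_k+t}$, the smallest closed interval containing it. Put $F_m=\bigcup_{I\in\mathcal F_m}I$ and $$\beta_m=\max\Big\{\tfrac{|L|}{|I|}: I\in\mathcal F_m,\ L\text{ a component of } I\setminus F_{m+1}\Big\},\qquad \Gamma_m=\min_{J\in\mathcal F_m}\frac{\sum_{I\in\mathcal F_{m+1},\,I\subseteq J}|I|}{|J|},$$ $$\gamma_m=\max\Big\{\tfrac{|J|}{|I|}: J\in\mathcal F_m,\ I\in\mathcal F_{m-1},\ J\subseteq I\Big\}\quad(m\ge1).$$ **The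 example.** For $k\ge1$ let $n_k=2^k$, $c_k=(2^{k+1}+k(\sqrt2)^k)^{-1}$, $\delta_k=c_1\cdots c_k$, $\eta_{k,0}=\eta_{k,n_k}=0$; let $\eta_{1,1}=1-2\delta_1$, and for $k\ge 2$ let $l_k=2^k-2^{k-\lfloor k/2\rfloor-1}$, $\eta_{k,l_k}=2\delta_k+k(\sqrt2)^k\delta_k$ and $\eta_{k,l}=\delta_k$ for $1\le l\le n_k-1$, $l\ne l_k$. **Claim.** A collection of intervals with the homogeneous perfect structure for these parameters exists, and for every such collection $E=\bigcap_{m\ge0} F_m$. Moreover: 1. There is $\tilde c_3>0$ with $n_k\min_{1\le l\le n_k-1}\eta_{k,l}\ge\tilde c_3\,c_1\cdots c_{k-1}$ for all $k\ge1$ (condition (3) of the Wen–Wu theorem). 2. Condition (A) fails: there is no $C\ge1$ with $\max_{1\le l\le n_k-1}\eta_{k,l}\le C\min_{1\le l\le n_k-1}\eta_{k,l}$ for all $k\ge1$. 3. Condition (B) fails: there is no $D>0$ with $\max_{1\le l\le n_k-1}\eta_{k,l}\le D\,c_1\cdots c_k$ for all $k\ge1$. 4. Condition (c) fails: there is no $K\ge1$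 with $\max_{I\in\mathcal F_m}|I|\le K\min_{I\in\mathcal F_m}|I|$ for all $m\ge1$. 5. The following three conditions hold: $(\tilde a)$ $\lim_{m\to\infty}\frac1m\sum_{j=0}^{m-1}\beta_j=0$; $(\tilde b)$ $\lim_{m\to\infty}\frac1m\sum_{j=0}^{m-1}\log\Gamma_j=0$; $(\tilde c)$ there is $\alpha\in(0,1)$ with $\liminf_{m\to\infty}\frac1m\#\{1\le i\le m:\gamma_i<\alpha\}>0$. 6. $E$ is 1-dimensional quasisymmetrically minimal: $\dim_H f(E)\ge\dim_H E$ for every homeomorphism $f:\mathbb R\to\mathbb R$ that is quasisymmetric, that is, for which there is a homeomorphism $\eta:[0,\infty)\to[0,\infty)$ with $\frac{|f(x)-f(a)|}{|f(x)-f(b)|}\le\eta\Big(\frac{|x-a|}{|x-b|}\Big)$ for all distinct $a,b,x\in\mathbb R$. -/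

import Mathlib

open Set Filter Topology MeasureTheory

/-- A homeomorphism `f : X → Y` is quasisymmetric if there is a homeomorphism `η` of `[0, ∞)` such
that `|f x - f a| / |f x - f b| ≤ η (|x - a| / |x - b|)` for all distinct `a, b, x`. -/
def IsQuasisymmetric {X Y : Type*} [MetricSpace X] [MetricSpace Y] (f : X ≃ₜ Y) : Prop :=
  ∃ η : NNReal ≃ₜ NNReal, ∀ a b x : X, a ≠ b → x ≠ a → x ≠ b →
    nndist (f x) (f a) / nndist (f x) (f b) ≤ η (nndist x a / nndist x b)

/-- Quasisymmetric maps of the ambient space onto itself do not lower the Hausdorff dimension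
of `E`. For `X = ℝ` this is 1-dimensional quasisymmetric minimality. -/
def IsQuasisymmetricallyMinimal {X : Type*} [MetricSpace X] (E : Set X) : Prop :=
  ∀ f : X ≃ₜ X, IsQuasisymmetric f → dimH E ≤ dimH (f '' E)

namespace HomogeneousPerfect

/-- The words `(i₁, …, i_k)` with `1 ≤ i_j ≤ n_j`; the word `σ * j` is `σ ++ [j]`. -/
def Words (n : ℕ → ℕ) : ℕ → Set (List ℕ)
  | 0 => {[]}
  | k + 1 => {τ | ∃ σ ∈ Words n k, ∃ j : ℕ, 1 ≤ j ∧ j ≤ n (k + 1) ∧ τ = σ ++ [j]}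

/-- `c₁ c₂ ⋯ c_k`. -/
noncomputable def prodC (c : ℕ → ℝ) (k : ℕ) : ℝ := ∏ j ∈ Finset.Icc 1 k, c j

/-- `max_{1 ≤ l ≤ n_k - 1} η_{k,l}`. -/
noncomputable def maxGap (n : ℕ → ℕ) (η : ℕ → ℕ → ℝ) (k : ℕ) : ℝ := sSup (η k '' Ico 1 (n k))

/-- `min_{1 ≤ l ≤ n_k - 1} η_{k,l}`. -/
noncomputable def minGap (n : ℕ → ℕ) (η : ℕ → ℕ → ℝ) (k : ℕ) : ℝ := sInf (η k '' Ico 1 (n k))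

/-- There is `C ≥ 1` with `max_l η_{k,l} ≤ C min_l η_{k,l}` for all `k ≥ 1`. -/
def CondA (n : ℕ → ℕ) (η : ℕ → ℕ → ℝ) : Prop :=
  ∃ C : ℝ, 1 ≤ C ∧ ∀ k : ℕ, 1 ≤ k → maxGap n η k ≤ C * minGap n η k

/-- There is `D > 0` with `max_l η_{k,l} ≤ D c₁ ⋯ c_k` for all `k ≥ 1`. -/
def CondB (n : ℕ → ℕ) (c : ℕ → ℝ) (η : ℕ → ℕ → ℝ) : Prop :=
  ∃ D : ℝ, 0 < D ∧ ∀ k : ℕ, 1 ≤ k → maxGap n η k ≤ D * prodC c k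

/-- There is `c₃ > 0` with `n_k min_l η_{k,l} ≥ c₃ c₁ ⋯ c_{k-1}` for all `k ≥ 1`. -/
def CondThree (n : ℕ → ℕ) (c : ℕ → ℝ) (η : ℕ → ℕ → ℝ) : Prop :=
  ∃ c₃ : ℝ, 0 < c₃ ∧ ∀ k : ℕ, 1 ≤ k → c₃ * prodC c (k - 1) ≤ (n k : ℝ) * minGap n η k

/-- A collection of intervals `J_σ = [lo σ, hi σ]` in `J_∅ = [0, 1]` with the homogeneous perfect
structure for the parameters `n_k`, `c_k` (`k ≥ 1`) and `η_{k,j}` (`k ≥ 1`, `0 ≤ j ≤ n_k`).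
Values of `lo`, `hi`, `n`, `c`, `η` outside these ranges are irrelevant. -/
structure System (n : ℕ → ℕ) (c : ℕ → ℝ) (η : ℕ → ℕ → ℝ) where
  two_le_n : ∀ k : ℕ, 1 ≤ k → 2 ≤ n k
  c_pos : ∀ k : ℕ, 1 ≤ k → 0 < c k
  c_lt_one : ∀ k : ℕ, 1 ≤ k → c k < 1
  eta_nonneg : ∀ k j : ℕ, 1 ≤ k → j ≤ n k → 0 ≤ η k j
  lo : List ℕ → ℝ
  hi : List ℕ → ℝ
  lo_root : lo [] = 0
  hi_root : hi [] = 1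
  lo_le_hi : ∀ k : ℕ, ∀ σ ∈ Words n k, lo σ ≤ hi σ
  subinterval : ∀ k : ℕ, ∀ σ ∈ Words n k, ∀ i : ℕ, 1 ≤ i → i ≤ n (k + 1) →
    Icc (lo (σ ++ [i])) (hi (σ ++ [i])) ⊆ Icc (lo σ) (hi σ)
  ordered : ∀ k : ℕ, ∀ σ ∈ Words n k, ∀ i : ℕ, 1 ≤ i → i + 1 ≤ n (k + 1) →
    hi (σ ++ [i]) ≤ lo (σ ++ [i + 1])
  ratio : ∀ k : ℕ, ∀ σ ∈ Words n k, ∀ i : ℕ, 1 ≤ i → i ≤ n (k + 1) →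
    (hi (σ ++ [i]) - lo (σ ++ [i])) / (hi σ - lo σ) = c (k + 1)
  gap_left : ∀ k : ℕ, ∀ σ ∈ Words n k, lo (σ ++ [1]) - lo σ = η (k + 1) 0
  gap_right : ∀ k : ℕ, ∀ σ ∈ Words n k,
    hi σ - hi (σ ++ [n (k + 1)]) = η (k + 1) (n (k + 1))
  gap_mid : ∀ k : ℕ, ∀ σ ∈ Words n k, ∀ i : ℕ, 1 ≤ i → i + 1 ≤ n (k + 1) →
    lo (σ ++ [i + 1]) - hi (σ ++ [i]) = η (k + 1) i

/-- Halving the children `1, …, N` of an interval `t` times. The pair `(p, q)` stands for the block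
of consecutive children `p + 1, …, q`. A block is cut at its midmost gap, at the left one of the
two midmost gaps if there are two, so that its first `⌊(q - p) / 2⌋` children are split off. -/
def blocks (N : ℕ) : ℕ → Set (ℕ × ℕ)
  | 0 => {(0, N)}
  | t + 1 => {b | ∃ p q : ℕ, (p, q) ∈ blocks N t ∧
      (b = (p, p + (q - p) / 2) ∨ b = (p + (q - p) / 2, q))}

/-- `i_k`, the integer with `2 ^ i_k ≤ n_k < 2 ^ (i_k + 1)`. -/
def numSteps (n : ℕ → ℕ) (k : ℕ) : ℕ := Nat.log 2 (n k)

/-- `m_k = i₁ + ⋯ + i_k`. -/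
def mIndex (n : ℕ → ℕ) (k : ℕ) : ℕ := ∑ j ∈ Finset.Icc 1 k, numSteps n j

namespace System

variable {n : ℕ → ℕ} {c : ℕ → ℝ} {η : ℕ → ℕ → ℝ}

/-- The homogeneous perfect set `E = ⋂_k ⋃_{σ ∈ Ω_k} J_σ`. -/
def E (H : System n c η) : Set ℝ := ⋂ k : ℕ, ⋃ σ ∈ Words n k, Icc (H.lo σ) (H.hi σ)

/-- Left endpoint of `J*_σ`, which is `J_σ` without its leftmost and rightmost gaps. -/
def starLo (H : System n c η) (σ : List ℕ) : ℝ := H.lo σ + η (σ.length + 1) 0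

/-- Right endpoint of `J*_σ`. -/
def starHi (H : System n c η) (σ : List ℕ) : ℝ :=
  H.hi σ - η (σ.length + 1) (n (σ.length + 1))

/-- The basic intervals of `F_{m_k + t}` for `0 ≤ t < i_{k+1}`. For `t = 0` these are the `J*_σ`
with `σ` of length `k`; for `t ≥ 1` they are the smallest intervals containing
`J*_{σ * (p + 1)}, …, J*_{σ * q}`, where `(p, q)` is a block obtained by `t` halvings. -/
def level (H : System n c η) (k : ℕ) : ℕ → Set (Set ℝ)
  | 0 => {I | ∃ σ ∈ Words n k, I = Icc (H.starLo σ) (H.starHi σ)}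
  | t + 1 => {I | ∃ σ ∈ Words n k, ∃ p q : ℕ, (p, q) ∈ blocks (n (k + 1)) (t + 1) ∧
      I = Icc (H.starLo (σ ++ [p + 1])) (H.starHi (σ ++ [q]))}

/-- The family of all basic intervals of `F_m`. The pair `(k, t)` with `m = m_k + t` and
`0 ≤ t < i_{k+1}` is unique. -/
def basic (H : System n c η) (m : ℕ) : Set (Set ℝ) :=
  {I | ∃ k t : ℕ, m = mIndex n k + t ∧ t < numSteps n (k + 1) ∧ I ∈ H.level k t}

/-- The set `F_m`. -/
def F (H : System n c η) (m : ℕ) : Set ℝ := ⋃₀ H.basic m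

/-- `β_m`: the largest `|L| / |I|`, where `I` is a basic interval of `F_m` and `L` is a component
of `I \ F_{m+1}`. -/
noncomputable def beta (H : System n c η) (m : ℕ) : ℝ :=
  sSup {r : ℝ | ∃ I ∈ H.basic m, ∃ x ∈ I \ H.F (m + 1),
    r = volume.real (connectedComponentIn (I \ H.F (m + 1)) x) / volume.real I}

/-- `C(J, 1)`: the sum of the lengths of the basic intervals of `F_{m+1}` that lie in `J`. -/
noncomputable def childLength (H : System n c η) (m : ℕ) (J : Set ℝ) : ℝ :=
  ∑ᶠ I ∈ {I : Set ℝ | I ∈ H.basic (m + 1) ∧ I ⊆ J}, volume.real I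

/-- `Γ_m`, the minimum of `C(J, 1) / |J|` over the basic intervals `J` of `F_m`. -/
noncomputable def bigGamma (H : System n c η) (m : ℕ) : ℝ :=
  sInf {r : ℝ | ∃ J ∈ H.basic m, r = H.childLength m J / volume.real J}

/-- `γ_m` (`m ≥ 1`), the maximum of `|J| / |Fa(J)|` over the basic intervals `J` of `F_m`, where
`Fa(J)` is the basic interval of `F_{m-1}` that contains `J`. -/
noncomputable def smallGamma (H : System n c η) (m : ℕ) : ℝ :=
  sSup {r : ℝ | ∃ J ∈ H.basic m, ∃ I ∈ H.basic (m - 1), J ⊆ I ∧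
    r = volume.real J / volume.real I}

/-- `(1/m) ∑_{j < m} β_j → 0`. -/
def CondATilde (H : System n c η) : Prop :=
  Tendsto (fun m : ℕ => (1 / (m : ℝ)) * ∑ j ∈ Finset.range m, H.beta j) atTop (𝓝 0)

/-- `(1/m) ∑_{j < m} log Γ_j → 0`. -/
def CondBTilde (H : System n c η) : Prop :=
  Tendsto (fun m : ℕ => (1 / (m : ℝ)) * ∑ j ∈ Finset.range m, Real.log (H.bigGamma j))
    atTop (𝓝 0)

/-- For some `α ∈ (0, 1)` the lower density of `{i ≥ 1 : γ_i < α}` is positive. -/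
def CondCTilde (H : System n c η) : Prop :=
  ∃ α : ℝ, 0 < α ∧ α < 1 ∧
    0 < liminf (fun m : ℕ =>
      (({i : ℕ | 1 ≤ i ∧ i ≤ m ∧ H.smallGamma i < α}.ncard : ℝ) / (m : ℝ))) atTop

/-- There is `K ≥ 1` such that, for every `m ≥ 1`, the longest basic interval of `F_m` is at most
`K` times as long as the shortest one. -/
def CondC (H : System n c η) : Prop :=
  ∃ K : ℝ, 1 ≤ K ∧ ∀ m : ℕ, 1 ≤ m →
    sSup (volume.real '' H.basic m) ≤ K * sInf (volume.real '' H.basic m)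

end System

/-- `n_k = 2 ^ k`. -/
def exN (k : ℕ) : ℕ := 2 ^ k

/-- `c_k = (2 ^ (k + 1) + k (√2) ^ k)⁻¹`. -/
noncomputable def exC (k : ℕ) : ℝ := (2 ^ (k + 1) + (k : ℝ) * Real.sqrt 2 ^ k)⁻¹

/-- `l_k = 2 ^ k - 2 ^ (k - ⌊k / 2⌋ - 1)`. -/
def exL (k : ℕ) : ℕ := 2 ^ k - 2 ^ (k - k / 2 - 1)

/-- With `δ_k = c₁ ⋯ c_k`: `η_{k,0} = η_{k,2^k} = 0`, `η_{1,1} = 1 - 2 δ₁`, and for `k ≥ 2` and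
`1 ≤ l ≤ 2 ^ k - 1`, `η_{k,l} = 2 δ_k + k (√2) ^ k δ_k` if `l = l_k` and `η_{k,l} = δ_k` if not. -/
noncomputable def exEta (k l : ℕ) : ℝ :=
  if l = 0 ∨ l = 2 ^ k then 0
  else if k = 1 then 1 - 2 * prodC exC k
  else if l = exL k then 2 * prodC exC k + (k : ℝ) * Real.sqrt 2 ^ k * prodC exC k
  else prodC exC k

end HomogeneousPerfect

/-! Every `n_k` is a power of two and the outer gaps vanish, so the families form a binary tree in
which the two children of an interval share its outer endpoints and leave one central gap. All
quantities of the claim are read off the lengths and gaps of this tree.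

A block of `2 ^ s` consecutive intervals of order `k` has length `(2 * 2 ^ s - 1) δ_k`, plus an
excess `(1 + k √2 ^ k) δ_k` if it contains the exceptional gap. Since `l_k = 2 ^ k - 2 ^ e` with `e
= k - ⌊k / 2⌋ - 1`, only the halving of blocks of `2 ^ (e + 1)` intervals cuts at this gap. Blocks
containing the gap have at least `√2 ^ k` intervals, so that halving keeps a proportion at least of
order `1 / k` and costs `O(log k)` on the logarithmic scale; the other costs of an order form a
geometric series. Reaching order `k` takes about `k² / 2` generations, so the total loss `O(k log
k)` is negligible on average. In about half of the generations the blocks are free of the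
exceptional gap and shrink by a factor of at least two. Blocks of about `√2 ^ k` intervals with and
without the gap have lengths of ratio about `k / 2`, which defeats condition (c).

For minimality, let `f` be increasing and quasisymmetric, and spread a unit mass over the image tree
in proportion to the lengths of children. The mass of an interval is at most a constant times its
length divided by the product of the proportions kept (`weight_le`). Quasisymmetry keeps relatively
small gaps small and distorts proportions at most by a power, so one generation loses at most `ε + A
β - q log Γ` (`exists_map_len_add_ge`), which sums to `ε m + o(m)`. In a positive proportion of the
generations image lengths contract by a fixed factor (`exists_map_len_le`), so they decay
exponentially. Hence for every `d < 1` masses are bounded by `d`-th powers of lengths, and the mass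
coordinate is a `d`-Hölder map from part of the limit set onto `[0, 1]` (`le_dimH_limitSet`).
Decreasing maps are composed with negation. -/

/-! ### Binary interval trees and a mass distribution principle -/

/-- A binary tree of nondegenerate closed intervals `[lo m j, hi m j]`: the children of the interval
`(m, j)` are `(m + 1, 2 * j)` and `(m + 1, 2 * j + 1)`; they are separated by a gap and they share
the left and the right endpoint of `(m, j)`, respectively. -/
structure IntervalTree where
  lo : ℕ → ℕ → ℝ
  hi : ℕ → ℕ → ℝ
  lo_lt_hi : ∀ m j, lo m j < hi m j
  lo_left : ∀ m j, lo (m + 1) (2 * j) = lo m j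
  hi_right : ∀ m j, hi (m + 1) (2 * j + 1) = hi m j
  hi_lt_lo : ∀ m j, hi (m + 1) (2 * j) < lo (m + 1) (2 * j + 1)

namespace IntervalTree

variable (T : IntervalTree)

/-- The length of an interval of the tree. -/
def len (m j : ℕ) : ℝ := T.hi m j - T.lo m j

/-- The length of the gap between the two children. -/
def gap (m j : ℕ) : ℝ := T.lo (m + 1) (2 * j + 1) - T.hi (m + 1) (2 * j)

/-- The union of the `2 ^ m` intervals of generation `m` below the root `(0, 0)`. -/
def level (m : ℕ) : Set ℝ := {x | ∃ j < 2 ^ m, x ∈ Icc (T.lo m j) (T.hi m j)}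

/-- The intersection of all generations. -/
def limitSet : Set ℝ := ⋂ m, T.level m

lemma len_pos (m j : ℕ) : 0 < T.len m j := sub_pos.2 (T.lo_lt_hi m j)

lemma gap_pos (m j : ℕ) : 0 < T.gap m j := sub_pos.2 (T.hi_lt_lo m j)

lemma len_eq (m j : ℕ) :
    T.len m j = T.len (m + 1) (2 * j) + T.gap m j + T.len (m + 1) (2 * j + 1) := by
  have h1 := T.lo_left m j
  have h2 := T.hi_right m j
  unfold len gap
  linarith

lemma lo_parent_le (m j : ℕ) : T.lo m (j / 2) ≤ T.lo (m + 1) j := by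
  rcases Nat.even_or_odd' j with ⟨i, rfl | rfl⟩
  · rw [T.lo_left]; simp
  · have h1 := T.lo_left m i
    have h2 := T.hi_lt_lo m i
    have h3 := T.lo_lt_hi (m + 1) (2 * i)
    rw [show (2 * i + 1) / 2 = i by omega]
    linarith

lemma hi_le_parent (m j : ℕ) : T.hi (m + 1) j ≤ T.hi m (j / 2) := by
  rcases Nat.even_or_odd' j with ⟨i, rfl | rfl⟩
  · have h1 := T.hi_right m i
    have h2 := T.hi_lt_lo m i
    have h3 := T.lo_lt_hi (m + 1) (2 * i + 1)
    rw [show (2 * i) / 2 = i by omega]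
    linarith
  · rw [T.hi_right, show (2 * i + 1) / 2 = i by omega]

/-- Mass of an interval: each interval distributes its mass to its children in proportion to
their lengths. -/
noncomputable def weight : ℕ → ℕ → ℝ
  | 0, _ => 1
  | m + 1, j => weight m (j / 2) *
      (T.len (m + 1) j / (T.len (m + 1) (2 * (j / 2)) + T.len (m + 1) (2 * (j / 2) + 1)))

/-- Total mass to the left of an interval. -/
noncomputable def start : ℕ → ℕ → ℝ
  | 0, _ => 0
  | m + 1, j => start m (j / 2) + if j % 2 = 1 then T.weight (m + 1) (j - 1) else 0

lemma weight_left (m j : ℕ) : T.weight (m + 1) (2 * j) =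
    T.weight m j * (T.len (m + 1) (2 * j) /
      (T.len (m + 1) (2 * j) + T.len (m + 1) (2 * j + 1))) := by
  rw [weight, show 2 * j / 2 = j by omega]

lemma weight_right (m j : ℕ) : T.weight (m + 1) (2 * j + 1) =
    T.weight m j * (T.len (m + 1) (2 * j + 1) /
      (T.len (m + 1) (2 * j) + T.len (m + 1) (2 * j + 1))) := by
  rw [weight, show (2 * j + 1) / 2 = j by omega]

lemma weight_add (m j : ℕ) :
    T.weight (m + 1) (2 * j) + T.weight (m + 1) (2 * j + 1) = T.weight m j := by
  have h1 := T.len_pos (m + 1) (2 * j)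
  have h2 := T.len_pos (m + 1) (2 * j + 1)
  rw [weight_left, weight_right]
  field_simp

lemma weight_pos (m j : ℕ) : 0 < T.weight m j := by
  induction m generalizing j with
  | zero => simp [weight]
  | succ m ih =>
    rw [weight]
    have h0 := T.len_pos (m + 1) j
    have h1 := T.len_pos (m + 1) (2 * (j / 2))
    have h2 := T.len_pos (m + 1) (2 * (j / 2) + 1)
    have := ih (j / 2)
    positivity

lemma start_left (m j : ℕ) : T.start (m + 1) (2 * j) = T.start m j := by
  rw [start, show 2 * j / 2 = j by omega]
  simp

lemma start_right (m j : ℕ) :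
    T.start (m + 1) (2 * j + 1) = T.start m j + T.weight (m + 1) (2 * j) := by
  rw [start, show (2 * j + 1) / 2 = j by omega, if_pos (by omega)]
  simp

/-- A child receives at most `len child / (g m * len parent)` of the mass of its parent; the product
of these factors telescopes. -/
lemma weight_le (g : ℕ → ℝ) (hg : ∀ m, 0 < g m)
    (hlen : ∀ m j, g m * T.len m j ≤ T.len (m + 1) (2 * j) + T.len (m + 1) (2 * j + 1))
    {l : ℝ} (hl : 0 < l) (hl0 : ∀ j, l ≤ T.len 0 j) (m j : ℕ) :
    T.weight m j ≤ l⁻¹ * T.len m j / ∏ i ∈ Finset.range m, g i := by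
  induction m generalizing j with
  | zero =>
    have := hl0 j
    simp only [weight, Finset.range_zero, Finset.prod_empty, div_one]
    rw [inv_mul_eq_div, le_div_iff₀ hl]
    linarith
  | succ m ih =>
    rw [weight, Finset.prod_range_succ]
    have h0 := T.len_pos (m + 1) j
    have h1 := T.len_pos (m + 1) (2 * (j / 2))
    have h2 := T.len_pos (m + 1) (2 * (j / 2) + 1)
    have hP : 0 < ∏ i ∈ Finset.range m, g i := Finset.prod_pos fun i _ => hg i
    have hgm := hg m
    have h3 := hlen m (j / 2)
    have h4 := T.len_pos m (j / 2)
    calc _ ≤ (l⁻¹ * T.len m (j / 2) / ∏ i ∈ Finset.range m, g i) *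
          (T.len (m + 1) j / (g m * T.len m (j / 2))) := by
          have := (T.weight_pos m (j / 2)).le
          gcongr
          exact ih _
      _ = _ := by field_simp

/-- The branch of the tree that follows the point of mass coordinate `y`. -/
noncomputable def addr (y : ℝ) : ℕ → ℕ
  | 0 => 0
  | m + 1 => if y ≤ T.start (m + 1) (2 * addr y m + 1) then 2 * addr y m else 2 * addr y m + 1

lemma addr_succ (y : ℝ) (m : ℕ) :
    T.addr y (m + 1) = 2 * T.addr y m ∨ T.addr y (m + 1) = 2 * T.addr y m + 1 := by
  rw [addr]; split_ifs <;> simp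

lemma addr_lt (y : ℝ) (m : ℕ) : T.addr y m < 2 ^ m := by
  induction m with
  | zero => simp [addr]
  | succ m ih =>
    rw [pow_succ]
    rcases T.addr_succ y m with h | h <;> omega

lemma addr_spec {y : ℝ} (hy : y ∈ Icc (0 : ℝ) 1) (m : ℕ) :
    T.start m (T.addr y m) ≤ y ∧ y ≤ T.start m (T.addr y m) + T.weight m (T.addr y m) := by
  induction m with
  | zero => simpa [start, weight] using hy
  | succ m ih =>
    rw [addr]
    have h1 := T.start_right m (T.addr y m)
    have h2 := T.start_left m (T.addr y m)
    have h3 := T.weight_add m (T.addr y m)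
    split_ifs with h
    · rw [h2]; exact ⟨ih.1, by linarith⟩
    · exact ⟨by linarith, by linarith⟩

/-- The point of the limit set on the branch that follows `y`. -/
noncomputable def point (y : ℝ) : ℝ := ⨆ m, T.lo m (T.addr y m)

lemma point_mem (y : ℝ) (m : ℕ) :
    T.point y ∈ Icc (T.lo m (T.addr y m)) (T.hi m (T.addr y m)) := by
  have hanti : Antitone fun m => Icc (T.lo m (T.addr y m)) (T.hi m (T.addr y m)) := by
    refine antitone_nat_of_succ_le fun m => Icc_subset_Icc ?_ ?_
    · have := T.lo_parent_le m (T.addr y (m + 1))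
      rwa [show T.addr y (m + 1) / 2 = T.addr y m by
        rcases T.addr_succ y m with h | h <;> omega] at this
    · have := T.hi_le_parent m (T.addr y (m + 1))
      rwa [show T.addr y (m + 1) / 2 = T.addr y m by
        rcases T.addr_succ y m with h | h <;> omega] at this
  exact mem_iInter.1 (ciSup_mem_iInter_Icc_of_antitone_Icc hanti fun m => (T.lo_lt_hi _ _).le) m

lemma point_mem_limitSet (y : ℝ) : T.point y ∈ T.limitSet :=
  mem_iInter.2 fun m => ⟨_, T.addr_lt y m, T.point_mem y m⟩

section Holder

variable {T} {C d : ℝ}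

/-- While the branch of `y` turns left, the left endpoint and the mass to its left do not change. At
the first right turn the point has passed a whole left child, whose `d`-th power already pays for
the full mass. If no right turn occurs within `N` steps, the second alternative holds. `stop_sub_le`
is the mirror image. -/
lemma sub_start_le (hC : 0 ≤ C) (hd : 0 ≤ d)
    (hl : ∀ m j, T.weight m j ≤ C * T.len (m + 1) (2 * j) ^ d) {y : ℝ} (hy : y ∈ Icc (0 : ℝ) 1)
    (N n : ℕ) :
    y - T.start n (T.addr y n) ≤ C * (T.point y - T.lo n (T.addr y n)) ^ d ∨
      y - T.start n (T.addr y n) ≤ T.weight (n + N) (T.addr y (n + N)) := by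
  induction N generalizing n with
  | zero => right; rw [Nat.add_zero]; linarith [(T.addr_spec hy n).2]
  | succ N ih =>
    rcases T.addr_succ y n with h | h
    · have := ih (n + 1)
      rw [show n + (N + 1) = n + 1 + N by ring]
      rwa [h, T.start_left, T.lo_left] at this
    · left
      have h1 := (T.addr_spec hy n).2
      have h2 := hl n (T.addr y n)
      have h3 := (T.point_mem y (n + 1)).1
      have h4 := T.hi_lt_lo n (T.addr y n)
      have h5 := T.lo_left n (T.addr y n)
      have h6 := T.len_pos (n + 1) (2 * T.addr y n)
      rw [h] at h3
      calc _ ≤ T.weight n (T.addr y n) := by linarith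
        _ ≤ _ := h2
        _ ≤ _ := by
          gcongr
          unfold len
          linarith

lemma stop_sub_le (hC : 0 ≤ C) (hd : 0 ≤ d)
    (hr : ∀ m j, T.weight m j ≤ C * T.len (m + 1) (2 * j + 1) ^ d) {y : ℝ}
    (hy : y ∈ Icc (0 : ℝ) 1) (N n : ℕ) :
    T.start n (T.addr y n) + T.weight n (T.addr y n) - y ≤
        C * (T.hi n (T.addr y n) - T.point y) ^ d ∨
      T.start n (T.addr y n) + T.weight n (T.addr y n) - y ≤
        T.weight (n + N) (T.addr y (n + N)) := by
  induction N generalizing n with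
  | zero => right; rw [Nat.add_zero]; linarith [(T.addr_spec hy n).1]
  | succ N ih =>
    rcases T.addr_succ y n with h | h
    · left
      have h1 := (T.addr_spec hy n).1
      have h2 := hr n (T.addr y n)
      have h3 := (T.point_mem y (n + 1)).2
      have h4 := T.hi_lt_lo n (T.addr y n)
      have h5 := T.hi_right n (T.addr y n)
      have h6 := T.len_pos (n + 1) (2 * T.addr y n + 1)
      rw [h] at h3
      calc _ ≤ T.weight n (T.addr y n) := by linarith
        _ ≤ _ := h2
        _ ≤ _ := by
          gcongr
          unfold len
          linarith
    · have := ih (n + 1)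
      rw [show n + (N + 1) = n + 1 + N by ring]
      have h3 := T.weight_add n (T.addr y n)
      rwa [h, T.start_right, T.hi_right, show T.start n (T.addr y n) +
        T.weight (n + 1) (2 * T.addr y n) + T.weight (n + 1) (2 * T.addr y n + 1) =
        T.start n (T.addr y n) + T.weight n (T.addr y n) by linarith] at this

lemma le_of_forall_le_or_le {a b : ℝ} {w : ℕ → ℝ} (hb : 0 ≤ b) (n : ℕ)
    (hw : Tendsto w atTop (𝓝 0)) (h : ∀ N, a ≤ b ∨ a ≤ w (n + N)) : a ≤ b := by
  by_contra hab
  have h1 : ∀ N, a ≤ w (N + n) := fun N => by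
    rw [add_comm]; exact (h N).resolve_left hab
  have := ge_of_tendsto' ((tendsto_add_atTop_iff_nat n).2 hw) h1
  linarith

/-- At the first generation where the branches of `y` and `z` separate, `z - y` is the mass right of
`y` in the left child plus the mass left of `z` in the right child. The two one-sided bounds give
the factor 2, and the gap between the children gives strictness. -/
lemma sub_le_point_sub_rpow (hC : 0 ≤ C) (hd : 0 ≤ d)
    (hl : ∀ m j, T.weight m j ≤ C * T.len (m + 1) (2 * j) ^ d)
    (hr : ∀ m j, T.weight m j ≤ C * T.len (m + 1) (2 * j + 1) ^ d)
    {w : ℕ → ℝ} (hw : Tendsto w atTop (𝓝 0)) (hTw : ∀ m j, T.weight m j ≤ w m)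
    {y z : ℝ} (hy : y ∈ Icc (0 : ℝ) 1) (hz : z ∈ Icc (0 : ℝ) 1) (hyz : y < z) :
    z - y ≤ 2 * C * (T.point z - T.point y) ^ d ∧ T.point y < T.point z := by
  classical
  have hex : ∃ m, T.addr y m ≠ T.addr z m := by
    by_contra! hne
    have h1 : ∀ m, z - y ≤ w m := fun m => by
      have h2 := (T.addr_spec hz m).2
      have h3 := (T.addr_spec hy m).1
      rw [← hne m] at h2
      linarith [hTw m (T.addr y m)]
    linarith [ge_of_tendsto' hw h1]
  obtain ⟨m, hm⟩ : ∃ m, Nat.find hex = m + 1 :=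
    Nat.exists_eq_succ_of_ne_zero fun h0 => by
      have := Nat.find_spec hex
      rw [h0] at this
      exact this rfl
  have hne : T.addr y (m + 1) ≠ T.addr z (m + 1) := hm ▸ Nat.find_spec hex
  have heq : T.addr y m = T.addr z m := by
    by_contra h
    exact Nat.find_min hex (by omega : m < Nat.find hex) h
  have hs := T.start_right m (T.addr y m)
  have hs' := T.start_left m (T.addr y m)
  have hwa := T.weight_add m (T.addr y m)
  have ay := T.addr_spec hy (m + 1)
  have az := T.addr_spec hz (m + 1)
  have key : T.addr y (m + 1) = 2 * T.addr y m ∧ T.addr z (m + 1) = 2 * T.addr y m + 1 := by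
    rcases T.addr_succ y m with h | h <;> rcases T.addr_succ z m with h' | h' <;>
      rw [← heq] at h'
    · exact absurd (h.trans h'.symm) hne
    · exact ⟨h, h'⟩
    · rw [h] at ay
      rw [h'] at az
      linarith [ay.1, az.2]
    · exact absurd (h.trans h'.symm) hne
  obtain ⟨ky, kz⟩ := key
  have py := (T.point_mem y (m + 1)).2
  have pz := (T.point_mem z (m + 1)).1
  have hg := T.hi_lt_lo m (T.addr y m)
  have b1 : T.start (m + 1) (T.addr y (m + 1)) + T.weight (m + 1) (T.addr y (m + 1)) - y ≤
      C * (T.hi (m + 1) (T.addr y (m + 1)) - T.point y) ^ d :=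
    le_of_forall_le_or_le (by have := sub_nonneg.2 py; positivity) (m + 1) hw fun N =>
      (stop_sub_le hC hd hr hy N (m + 1)).imp_right fun h => h.trans (hTw _ _)
  have b2 : z - T.start (m + 1) (T.addr z (m + 1)) ≤
      C * (T.point z - T.lo (m + 1) (T.addr z (m + 1))) ^ d :=
    le_of_forall_le_or_le (by have := sub_nonneg.2 pz; positivity) (m + 1) hw fun N =>
      (sub_start_le hC hd hl hz N (m + 1)).imp_right fun h => h.trans (hTw _ _)
  rw [ky] at b1 py
  rw [kz] at b2 pz
  refine ⟨?_, by linarith⟩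
  have c1 : (T.hi (m + 1) (2 * T.addr y m) - T.point y) ^ d ≤ (T.point z - T.point y) ^ d :=
    Real.rpow_le_rpow (by linarith) (by linarith) hd
  have c2 : (T.point z - T.lo (m + 1) (2 * T.addr y m + 1)) ^ d ≤ (T.point z - T.point y) ^ d :=
    Real.rpow_le_rpow (by linarith) (by linarith) hd
  have := mul_le_mul_of_nonneg_left c1 hC
  have := mul_le_mul_of_nonneg_left c2 hC
  linarith

/-- If the mass of each interval is at most a constant times the `d`-th power of the length of
either child, then the limit set has dimension at least `d`. -/
theorem le_dimH_limitSet (hC : 0 ≤ C) (hd : 0 < d)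
    (hl : ∀ m j, T.weight m j ≤ C * T.len (m + 1) (2 * j) ^ d)
    (hr : ∀ m j, T.weight m j ≤ C * T.len (m + 1) (2 * j + 1) ^ d)
    {w : ℕ → ℝ} (hw : Tendsto w atTop (𝓝 0)) (hTw : ∀ m j, T.weight m j ≤ w m) :
    ENNReal.ofReal d ≤ dimH T.limitSet := by
  have key := fun {y z : ℝ} (hy : y ∈ Icc (0 : ℝ) 1) (hz : z ∈ Icc (0 : ℝ) 1) (h : y < z) =>
    sub_le_point_sub_rpow hC hd.le hl hr hw hTw hy hz h
  have hinj : InjOn T.point (Icc 0 1) := by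
    have hmono : StrictMonoOn T.point (Icc 0 1) := fun y hy z hz h => (key hy hz h).2
    exact hmono.injOn
  -- The inverse of `point` is `d`-Hölder and maps a subset of the limit set onto `[0, 1]`, which
  -- has dimension one.
  set g := Function.invFunOn T.point (Icc (0 : ℝ) 1)
  have hg : LeftInvOn g T.point (Icc 0 1) := hinj.leftInvOn_invFunOn
  have hdist : ∀ y ∈ Icc (0 : ℝ) 1, ∀ z ∈ Icc (0 : ℝ) 1,
      dist y z ≤ 2 * C * dist (T.point y) (T.point z) ^ d := by
    intro y hy z hz
    rcases lt_trichotomy y z with h | rfl | h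
    · obtain ⟨h1, h2⟩ := key hy hz h
      rw [dist_comm y, dist_comm (T.point y), Real.dist_eq, Real.dist_eq, abs_of_pos (sub_pos.2 h),
        abs_of_pos (sub_pos.2 h2)]
      exact h1
    · simp only [dist_self]; positivity
    · obtain ⟨h1, h2⟩ := key hz hy h
      rw [Real.dist_eq, Real.dist_eq, abs_of_pos (sub_pos.2 h), abs_of_pos (sub_pos.2 h2)]
      exact h1
  have hH : HolderOnWith (2 * C).toNNReal d.toNNReal g (T.point '' Icc 0 1) := by
    rintro _ ⟨y, hy, rfl⟩ _ ⟨z, hz, rfl⟩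
    rw [hg hy, hg hz, edist_dist, edist_dist, Real.coe_toNNReal d hd.le,
      ENNReal.ofReal_rpow_of_nonneg dist_nonneg hd.le]
    change _ ≤ ENNReal.ofReal (2 * C) * _
    rw [← ENNReal.ofReal_mul (by positivity)]
    exact ENNReal.ofReal_le_ofReal (hdist y hy z hz)
  have hd' : 0 < d.toNNReal := Real.toNNReal_pos.2 hd
  have h1 := hH.dimH_image_le hd'
  rw [hg.image_image] at h1
  have h2 : dimH (Icc (0 : ℝ) 1) = 1 := by
    rw [Real.dimH_of_nonempty_interior (by simp)]
    simp
  have h3 : dimH (T.point '' Icc 0 1) ≤ dimH T.limitSet :=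
    dimH_mono (by rintro _ ⟨y, -, rfl⟩; exact T.point_mem_limitSet y)
  rw [h2, ENNReal.le_div_iff_mul_le (by simp [hd]) (by simp), one_mul] at h1
  exact h1.trans h3

end Holder

end IntervalTree

/-! ### Distortion of lengths under quasisymmetric maps -/

namespace IsQuasisymmetric

/-- A decreasing bijection of `[0, ∞)` would be bounded by its value at 0, so the control function
increases and fixes 0. -/
lemma exists_real_control {f : ℝ ≃ₜ ℝ} (hf : IsQuasisymmetric f) :
    ∃ η : ℝ → ℝ, Monotone η ∧ (∀ r, 0 ≤ η r) ∧ Tendsto η (𝓝 0) (𝓝 0) ∧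
      ∀ a b x : ℝ, a ≠ b → x ≠ a → x ≠ b →
        |f x - f a| ≤ η (|x - a| / |x - b|) * |f x - f b| := by
  obtain ⟨η, hη⟩ := hf
  have hmono : StrictMono η := by
    rcases η.continuous.strictMono_of_inj η.injective with h | h
    · exact h
    · obtain ⟨x, hx⟩ := η.surjective (η 0 + 1)
      have : η x ≤ η 0 := h.antitone zero_le
      rw [hx] at this
      exact absurd this (by simp)
  have h0 : η 0 = 0 := by
    obtain ⟨x, hx⟩ := η.surjective 0
    exact le_antisymm ((hmono.monotone (zero_le : 0 ≤ x)).trans_eq hx) zero_le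
  refine ⟨fun r => η r.toNNReal, fun r s hrs => ?_, fun r => NNReal.coe_nonneg _, ?_, ?_⟩
  · exact NNReal.coe_le_coe.2 (hmono.monotone (Real.toNNReal_mono hrs))
  · have : Continuous fun r : ℝ => (η r.toNNReal : ℝ) :=
      NNReal.continuous_coe.comp (η.continuous.comp continuous_real_toNNReal)
    simpa [h0] using this.tendsto 0
  · intro a b x hab hxa hxb
    have h1 := hη a b x hab hxa hxb
    have h2 : 0 < |f x - f b| := abs_pos.2 (sub_ne_zero.2 (f.injective.ne hxb))
    have h3 : (nndist x a / nndist x b) = (|x - a| / |x - b|).toNNReal := by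
      apply NNReal.eq
      rw [Real.coe_toNNReal _ (by positivity)]
      simp [Real.dist_eq]
    rw [h3, ← NNReal.coe_le_coe] at h1
    simp only [NNReal.coe_div, coe_nndist, Real.dist_eq] at h1
    exact (div_le_iff₀ h2).1 h1

/-- Upper and lower distortion bounds for the lengths of the images of subintervals. -/
theorem exists_distortion {f : ℝ ≃ₜ ℝ} (hf : IsQuasisymmetric f) (hmono : StrictMono f) :
    ∃ η : ℝ → ℝ, ∃ q : ℝ, 0 ≤ q ∧ Tendsto η (𝓝 0) (𝓝 0) ∧ Monotone η ∧
      (∀ a u v b : ℝ, a < u → u < v → v < b →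
        f v - f u ≤ η ((v - u) / (b - a)) * (f b - f a)) ∧
      (∀ a u v b ρ : ℝ, a ≤ u → u < v → v ≤ b → 0 < ρ → ρ * (b - a) ≤ v - u →
        Real.exp (-(q * (1 - Real.log ρ))) * (f b - f a) ≤ f v - f u) := by
  obtain ⟨η, hη, hη0, hlim, hq⟩ := hf.exists_real_control
  have habs : ∀ {x y : ℝ}, x ≤ y → |f x - f y| = f y - f x ∧ |f y - f x| = f y - f x :=
    fun h => by
      have := hmono.monotone h
      exact ⟨by rw [abs_sub_comm, abs_of_nonneg (by linarith)], abs_of_nonneg (by linarith)⟩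
  -- If `[u, v]` fills at least half of `[a, b]`, each flank is no longer than `[u, v]`, so its
  -- image is at most `η 1` times the image of `[u, v]`.
  set Q : ℝ := 1 + 2 * η 1
  have hQ1 : 1 ≤ Q := by have := hη0 1; simp only [Q]; linarith
  have hhalf : ∀ a u v b : ℝ, a ≤ u → u < v → v ≤ b → b - a ≤ 2 * (v - u) →
      f b - f a ≤ Q * (f v - f u) := by
    intro a u v b hau huv hvb hh
    have hpos : 0 < f v - f u := sub_pos.2 (hmono huv)
    have h1 : f u - f a ≤ η 1 * (f v - f u) := by
      rcases hau.eq_or_lt with rfl | hau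
      · rw [sub_self]; exact mul_nonneg (hη0 1) hpos.le
      · have h := hq a v u (by linarith) hau.ne' huv.ne
        rw [(habs hau.le).2, (habs huv.le).1, abs_of_pos (sub_pos.2 hau),
          abs_of_neg (sub_neg.2 huv)] at h
        refine h.trans (mul_le_mul_of_nonneg_right (hη ?_) hpos.le)
        rw [div_le_one (by linarith)]
        linarith
    have h2 : f b - f v ≤ η 1 * (f v - f u) := by
      rcases hvb.eq_or_lt with rfl | hvb
      · rw [sub_self]; exact mul_nonneg (hη0 1) hpos.le
      · have h := hq b u v (by linarith) hvb.ne huv.ne'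
        rw [(habs hvb.le).1, (habs huv.le).2, abs_of_pos (sub_pos.2 huv),
          abs_of_neg (sub_neg.2 hvb)] at h
        refine h.trans (mul_le_mul_of_nonneg_right (hη ?_) hpos.le)
        rw [div_le_one (by linarith)]
        linarith
    simp only [Q]
    linarith
  have hpow : ∀ (N : ℕ) (a u v b : ℝ), a ≤ u → u < v → v ≤ b → b - a ≤ 2 ^ N * (v - u) →
      f b - f a ≤ Q ^ N * (f v - f u) := by
    intro N
    induction N with
    | zero =>
      intro a u v b hau huv hvb hh
      rw [pow_zero, one_mul] at hh
      rw [show a = u by linarith, show b = v by linarith]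
      simp
    | succ N ih =>
      intro a u v b hau huv hvb hh
      have hpos : 0 < f v - f u := sub_pos.2 (hmono huv)
      by_cases hc : b - a ≤ 2 * (v - u)
      · refine (hhalf a u v b hau huv hvb hc).trans (mul_le_mul_of_nonneg_right ?_ hpos.le)
        exact le_self_pow₀ hQ1 (Nat.succ_ne_zero N)
      · push Not at hc
        -- `a'` is the left end of an interval of half the length between `[u, v]` and `[a, b]`; the
        -- inner inclusion falls to the induction hypothesis, the outer one to `hhalf`.
        set a' := max a (v - (b - a) / 2)
        have ha1 : a ≤ a' := le_max_left _ _
        have ha2 : v - (b - a) / 2 ≤ a' := le_max_right _ _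
        have ha3 : a' ≤ u := max_le hau (by linarith)
        have hb' : a' + (b - a) / 2 ≤ b := by
          rw [← le_sub_iff_add_le]
          exact max_le (by linarith) (by linarith)
        have h1 := ih a' u v (a' + (b - a) / 2) ha3 huv (by linarith) (by
          rw [pow_succ] at hh
          linarith)
        have h2 := hhalf a a' (a' + (b - a) / 2) b ha1 (by linarith) hb' (by linarith)
        rw [pow_succ']
        nlinarith
  -- The factor 2 appears because one of `b - u` and `v - a` is at least half of `b - a`. The
  -- exponent `log Q / log 2` comes from `N` doublings with `N` about `log₂ (1 / ρ)`; rounding `N`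
  -- up costs `log 2 ≤ 1`, whence the 1 in `1 - log ρ`.
  refine ⟨fun r => η (2 * r), Real.log Q / Real.log 2,
    div_nonneg (Real.log_nonneg hQ1) (Real.log_nonneg one_le_two), ?_,
    fun r s h => hη (by linarith), ?_, ?_⟩
  · have : Tendsto (fun r : ℝ => 2 * r) (𝓝 0) (𝓝 0) := by
      simpa using (continuous_const_mul (2 : ℝ)).tendsto (0 : ℝ)
    exact hlim.comp this
  · intro a u v b hau huv hvb
    have hab : 0 < b - a := by linarith
    have hle : ∀ t : ℝ, (b - a) / 2 ≤ t → (v - u) / t ≤ 2 * ((v - u) / (b - a)) := by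
      intro t ht
      have ht0 : 0 < t := by linarith
      have : 0 < v - u := by linarith
      rw [← mul_div_assoc, div_le_div_iff₀ ht0 hab]
      nlinarith
    have hm1 : f a ≤ f u := hmono.monotone hau.le
    have hm2 : f v ≤ f b := hmono.monotone hvb.le
    by_cases hc : (b - a) / 2 ≤ b - u
    · have h := hq v b u (by linarith) huv.ne (by linarith)
      rw [(habs huv.le).1, (habs (huv.trans hvb).le).1, abs_of_neg (sub_neg.2 huv),
        abs_of_neg (sub_neg.2 (huv.trans hvb)), neg_sub, neg_sub] at h
      exact h.trans (mul_le_mul (hη (hle _ hc)) (by linarith)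
        (sub_nonneg.2 (hmono.monotone (huv.trans hvb).le)) (hη0 _))
    · have h := hq u a v (by linarith) huv.ne' (by linarith)
      rw [(habs huv.le).2, (habs (hau.trans huv).le).2, abs_of_pos (sub_pos.2 huv),
        abs_of_pos (sub_pos.2 (hau.trans huv))] at h
      exact h.trans (mul_le_mul (hη (hle _ (by linarith))) (by linarith)
        (sub_nonneg.2 (hmono.monotone (hau.trans huv).le)) (hη0 _))
  · intro a u v b ρ hau huv hvb hρ hρl
    have hab : 0 < b - a := by linarith
    have hpos : 0 < f v - f u := sub_pos.2 (hmono huv)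
    have hρ1 : ρ ≤ 1 := by
      by_contra! h
      nlinarith
    have hlog2 : 0 < Real.log 2 := Real.log_pos one_lt_two
    have hlogρ : Real.log ρ ≤ 0 := Real.log_nonpos hρ.le hρ1
    set N := ⌈-Real.log ρ / Real.log 2⌉₊
    have hN1 : -Real.log ρ / Real.log 2 ≤ N := Nat.le_ceil _
    have hN2 : (N : ℝ) < -Real.log ρ / Real.log 2 + 1 :=
      Nat.ceil_lt_add_one (div_nonneg (by linarith) hlog2.le)
    have h2N : ρ⁻¹ ≤ 2 ^ N := by
      rw [← Real.log_le_log_iff (by positivity) (by positivity), Real.log_inv, Real.log_pow]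
      rwa [div_le_iff₀ hlog2] at hN1
    have h1 := hpow N a u v b hau huv hvb (by
      calc b - a = ρ⁻¹ * (ρ * (b - a)) := by field_simp
        _ ≤ 2 ^ N * (v - u) := mul_le_mul h2N hρl (by positivity) (by positivity))
    have h2 : Q ^ N ≤ Real.exp (Real.log Q / Real.log 2 * (1 - Real.log ρ)) := by
      rw [← Real.log_le_iff_le_exp (by positivity), Real.log_pow]
      have hl1 : Real.log 2 ≤ 1 := by linarith [Real.log_two_lt_d9]
      have h3 : (N : ℝ) * Real.log 2 ≤ 1 - Real.log ρ := by
        have : (N : ℝ) * Real.log 2 < (-Real.log ρ / Real.log 2 + 1) * Real.log 2 :=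
          mul_lt_mul_of_pos_right hN2 hlog2
        rw [add_mul, div_mul_cancel₀ _ hlog2.ne'] at this
        linarith
      rw [div_mul_eq_mul_div, le_div_iff₀ hlog2]
      nlinarith [Real.log_nonneg hQ1]
    rw [Real.exp_neg, inv_mul_le_iff₀ (Real.exp_pos _)]
    exact h1.trans (mul_le_mul_of_nonneg_right h2 hpos.le)

end IsQuasisymmetric

/-! ### Dimension of quasisymmetric images of trees -/

namespace IntervalTree

/-- The image of a tree of intervals under a strictly increasing map. -/
def map (T : IntervalTree) (f : ℝ → ℝ) (hf : StrictMono f) : IntervalTree where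
  lo m j := f (T.lo m j)
  hi m j := f (T.hi m j)
  lo_lt_hi m j := hf (T.lo_lt_hi m j)
  lo_left m j := by rw [T.lo_left]
  hi_right m j := by rw [T.hi_right]
  hi_lt_lo m j := hf (T.hi_lt_lo m j)

lemma limitSet_map_subset (T : IntervalTree) (f : ℝ ≃ₜ ℝ) (hf : StrictMono f) :
    (T.map f hf).limitSet ⊆ f '' T.limitSet := by
  intro x hx
  refine ⟨f.symm x, mem_iInter.2 fun m => ?_, f.apply_symm_apply x⟩
  obtain ⟨j, hj, h1, h2⟩ := mem_iInter.1 hx m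
  refine ⟨j, hj, hf.le_iff_le.1 ?_, hf.le_iff_le.1 ?_⟩
  · rwa [f.apply_symm_apply]
  · rwa [f.apply_symm_apply]

/-- Length bounds on a tree that make the dimension of its limit set at least `d`. -/
theorem le_dimH_limitSet_of_len (T : IntervalTree) {d l B : ℝ} (hd : 0 < d) (hd1 : d ≤ 1)
    (hl : 0 < l) (hl0 : ∀ j, l ≤ T.len 0 j) (hB : 0 ≤ B)
    {g κ M : ℕ → ℝ} (hg : ∀ m, 0 < g m) (hκ : ∀ m, 0 < κ m)
    (hgl : ∀ m j, g m * T.len m j ≤ T.len (m + 1) (2 * j) + T.len (m + 1) (2 * j + 1))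
    (hκl : ∀ m j, κ m * T.len m j ≤ T.len (m + 1) (2 * j))
    (hκr : ∀ m j, κ m * T.len m j ≤ T.len (m + 1) (2 * j + 1))
    (hM : ∀ m j, T.len m j ≤ M m) (hM0 : Tendsto M atTop (𝓝 0))
    (hmain : ∀ m, M m ^ (1 - d) ≤ B * (κ m ^ d * ∏ i ∈ Finset.range m, g i)) :
    ENNReal.ofReal d ≤ dimH T.limitSet := by
  have hMpos : ∀ m, 0 < M m := fun m => (T.len_pos m 0).trans_le (hM m 0)
  have hP : ∀ m, 0 < ∏ i ∈ Finset.range m, g i := fun m => Finset.prod_pos fun i _ => hg i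
  have key : ∀ m j (c : ℝ), κ m * T.len m j ≤ c → T.weight m j ≤ l⁻¹ * B * c ^ d := by
    intro m j c hc
    have hlen := T.len_pos m j
    have hκm := hκ m
    have hc0 : 0 < c := lt_of_lt_of_le (by positivity) hc
    refine (T.weight_le g hg hgl hl hl0 m j).trans ?_
    rw [div_le_iff₀ (hP m), mul_assoc, mul_assoc]
    refine mul_le_mul_of_nonneg_left ?_ (inv_pos.2 hl).le
    -- One factor `len ^ d` stays as the required bound; the surplus `len ^ (1 - d)` pays for the
    -- lost length and for passing from the parent to a child.
    have h1 : T.len m j = T.len m j ^ d * T.len m j ^ (1 - d) := by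
      rw [← Real.rpow_add hlen]; simp
    have h2 : T.len m j ^ (1 - d) ≤ M m ^ (1 - d) :=
      Real.rpow_le_rpow hlen.le (hM m j) (by linarith)
    have h3 : κ m ^ d * T.len m j ^ d ≤ c ^ d := by
      rw [← Real.mul_rpow hκm.le hlen.le]
      exact Real.rpow_le_rpow (by positivity) hc hd.le
    calc T.len m j ≤ T.len m j ^ d * (B * (κ m ^ d * ∏ i ∈ Finset.range m, g i)) := by
          conv_lhs => rw [h1]
          exact mul_le_mul_of_nonneg_left (h2.trans (hmain m)) (by positivity)
      _ = B * ((κ m ^ d * T.len m j ^ d) * ∏ i ∈ Finset.range m, g i) := by ring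
      _ ≤ _ := mul_le_mul_of_nonneg_left (mul_le_mul_of_nonneg_right h3 (hP m).le) hB
  have hC : 0 ≤ l⁻¹ * B := by positivity
  refine le_dimH_limitSet hC hd (fun m j => key m j _ (hκl m j)) (fun m j => key m j _ (hκr m j))
    (w := fun m => l⁻¹ * B * M (m + 1) ^ d) ?_ fun m j => ?_
  · have h1 := ((tendsto_add_atTop_iff_nat 1).2 hM0).rpow_const (p := d) (Or.inr hd.le)
    rw [Real.zero_rpow hd.ne'] at h1
    simpa using h1.const_mul (l⁻¹ * B)
  · refine (key m j _ (hκl m j)).trans (mul_le_mul_of_nonneg_left ?_ hC)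
    exact Real.rpow_le_rpow (T.len_pos _ _).le (hM _ _) hd.le

end IntervalTree

/-- A sequence that is `o(m)` is eventually below `δ m`; the constant `B` absorbs the finitely many
earlier terms. -/
lemma exists_le_mul_add_of_tendsto_avg {u : ℕ → ℝ}
    (hu : Tendsto (fun m : ℕ => (1 / (m : ℝ)) * u m) atTop (𝓝 0)) {δ : ℝ} (hδ : 0 < δ) :
    ∃ B : ℝ, ∀ m, u m ≤ δ * m + B := by
  obtain ⟨M, hM⟩ := eventually_atTop.1 (hu.eventually (gt_mem_nhds hδ))
  refine ⟨∑ i ∈ Finset.range (M + 1), |u i|, fun m => ?_⟩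
  have hS : 0 ≤ ∑ i ∈ Finset.range (M + 1), |u i| := Finset.sum_nonneg fun i _ => abs_nonneg _
  rcases lt_or_ge m (M + 1) with h | h
  · have h1 : |u m| ≤ ∑ i ∈ Finset.range (M + 1), |u i| :=
      Finset.single_le_sum (f := fun i => |u i|) (fun i _ => abs_nonneg _) (Finset.mem_range.2 h)
    have h2 : 0 ≤ δ * m := by positivity
    linarith [le_abs_self (u m)]
  · have h1 := hM m (by omega)
    have h2 : (0 : ℝ) < m := by exact_mod_cast (by omega : 0 < m)
    rw [one_div_mul_eq_div, div_lt_iff₀ h2] at h1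
    linarith

namespace IntervalTree

/-- Loss of total length in one generation of the image of a tree under a quasisymmetric map. -/
lemma exists_map_len_add_ge {f : ℝ ≃ₜ ℝ} (hf : IsQuasisymmetric f) (hmono : StrictMono f)
    {ε : ℝ} (hε : 0 < ε) : ∃ A q : ℝ, 0 ≤ A ∧ 0 ≤ q ∧ ∀ (T : IntervalTree) (m j : ℕ) (β Γ : ℝ),
      T.gap m j ≤ β * T.len m j → 0 < Γ → T.gap m j ≤ (1 - Γ) * T.len m j →
      Real.exp (-(ε + A * β - q * Real.log Γ)) * (T.map f hmono).len m j ≤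
        (T.map f hmono).len (m + 1) (2 * j) + (T.map f hmono).len (m + 1) (2 * j + 1) := by
  obtain ⟨η, q, hq, hlim, hη, hup, hlow⟩ := hf.exists_distortion hmono
  have hε1 : 0 < 1 - Real.exp (-ε) := by
    rw [sub_pos, Real.exp_lt_one_iff]; linarith
  obtain ⟨r, hr, hball⟩ := Metric.eventually_nhds_iff.1 (hlim.eventually (gt_mem_nhds hε1))
  have hr2 : η (r / 2) < 1 - Real.exp (-ε) := hball (by
    rw [Real.dist_eq, sub_zero, abs_of_pos (by linarith)]; linarith)
  have hlog2 : 0 ≤ Real.log 2 := Real.log_nonneg one_le_two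
  have hA : 0 ≤ q * (1 + Real.log 2) / (r / 2) := by positivity
  -- Gaps of proportion at most `r / 2` cost at most `ε`. For larger gaps `β` exceeds `r / 2`, and
  -- `A` makes `A * β` at least `q * (1 + log 2)`, the constant part of the lower distortion bound
  -- for the proportion `Γ / 2`.
  refine ⟨q * (1 + Real.log 2) / (r / 2), q, hA, hq, fun T m j β Γ hβ hΓ hgΓ => ?_⟩
  have hlen := T.len_pos m j
  have hgap := T.gap_pos m j
  have hlenf := (T.map f hmono).len_pos m j
  have hgapf := (T.map f hmono).gap_pos m j
  have hsplit := T.len_eq m j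
  have hsplitf := (T.map f hmono).len_eq m j
  have h0 := T.len_pos (m + 1) (2 * j)
  have h1 := T.len_pos (m + 1) (2 * j + 1)
  have h0f := (T.map f hmono).len_pos (m + 1) (2 * j)
  have h1f := (T.map f hmono).len_pos (m + 1) (2 * j + 1)
  have hβ0 : 0 < β := by
    by_contra! h
    nlinarith
  have hΓ1 : Γ ≤ 1 := by
    by_contra! h
    nlinarith
  have hlogΓ : Real.log Γ ≤ 0 := Real.log_nonpos hΓ.le hΓ1
  have hqΓ : q * Real.log Γ ≤ 0 := mul_nonpos_of_nonneg_of_nonpos hq hlogΓ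
  by_cases hc : T.gap m j / T.len m j ≤ r / 2
  · have h2 := hup (T.lo m j) (T.hi (m + 1) (2 * j)) (T.lo (m + 1) (2 * j + 1)) (T.hi m j)
      (by have := T.lo_lt_hi (m + 1) (2 * j); rwa [T.lo_left] at this) (T.hi_lt_lo m j)
      (by have := T.lo_lt_hi (m + 1) (2 * j + 1); rwa [T.hi_right] at this)
    change (T.map f hmono).gap m j ≤ η (T.gap m j / T.len m j) * (T.map f hmono).len m j at h2
    have h3 : η (T.gap m j / T.len m j) * (T.map f hmono).len m j ≤
        (1 - Real.exp (-ε)) * (T.map f hmono).len m j :=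
      mul_le_mul_of_nonneg_right ((hη hc).trans hr2.le) hlenf.le
    have h4 : Real.exp (-(ε + q * (1 + Real.log 2) / (r / 2) * β - q * Real.log Γ)) ≤
        Real.exp (-ε) := Real.exp_le_exp.2 (by have := mul_nonneg hA hβ0.le; linarith)
    have h5 := mul_le_mul_of_nonneg_right h4 hlenf.le
    linarith
  · push Not at hc
    have hrβ : r / 2 ≤ β := by
      rw [lt_div_iff₀ hlen] at hc
      by_contra! h
      nlinarith
    have h4 : Real.exp (-(ε + q * (1 + Real.log 2) / (r / 2) * β - q * Real.log Γ)) ≤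
        Real.exp (-(q * (1 - Real.log (Γ / 2)))) := by
      rw [Real.log_div hΓ.ne' two_ne_zero]
      apply Real.exp_le_exp.2
      have : q * (1 + Real.log 2) ≤ q * (1 + Real.log 2) / (r / 2) * β := by
        rw [div_mul_eq_mul_div, le_div_iff₀ (by positivity)]
        exact mul_le_mul_of_nonneg_left hrβ (by positivity)
      linarith
    have h5 := mul_le_mul_of_nonneg_right h4 hlenf.le
    -- The children together fill the proportion `Γ`, so one of them fills half of it; its image
    -- alone suffices.
    have hbig : Γ / 2 * T.len m j ≤ T.len (m + 1) (2 * j) ∨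
        Γ / 2 * T.len m j ≤ T.len (m + 1) (2 * j + 1) := by
      by_contra! h
      linarith [h.1, h.2]
    rcases hbig with hb | hb
    · have h6 := hlow (T.lo m j) (T.lo (m + 1) (2 * j)) (T.hi (m + 1) (2 * j)) (T.hi m j)
        (Γ / 2) (T.lo_left m j).ge (T.lo_lt_hi _ _) (by
          have h7 := T.hi_right m j
          have h8 := T.hi_lt_lo m j
          unfold len at h1
          linarith) (by positivity) hb
      change _ * (T.map f hmono).len m j ≤ (T.map f hmono).len (m + 1) (2 * j) at h6
      linarith
    · have h6 := hlow (T.lo m j) (T.lo (m + 1) (2 * j + 1)) (T.hi (m + 1) (2 * j + 1)) (T.hi m j)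
        (Γ / 2) (by
          have h7 := T.lo_left m j
          have h8 := T.hi_lt_lo m j
          unfold len at h0
          linarith) (T.lo_lt_hi _ _) (T.hi_right m j).le (by positivity) hb
      change _ * (T.map f hmono).len m j ≤ (T.map f hmono).len (m + 1) (2 * j + 1) at h6
      linarith

/-- If both children occupy a proportion at most `α < 1` of an interval, then the images of the
children occupy a proportion of the image which is bounded away from one. -/
lemma exists_map_len_le {f : ℝ ≃ₜ ℝ} (hf : IsQuasisymmetric f) (hmono : StrictMono f)
    {α : ℝ} (hα : α < 1) : ∃ τ : ℝ, 0 < τ ∧ ∀ (T : IntervalTree) (m j : ℕ),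
      T.len (m + 1) j ≤ α * T.len m (j / 2) →
      (T.map f hmono).len (m + 1) j ≤ Real.exp (-τ) * (T.map f hmono).len m (j / 2) := by
  obtain ⟨η, q, hq, hlim, hη, hup, hlow⟩ := hf.exists_distortion hmono
  -- A child shares an endpoint with its parent, so its complement in the parent is one interval of
  -- proportion at least `1 - α`, up to an endpoint. Its image keeps at least the proportion `τ`,
  -- and `1 - τ ≤ exp (-τ)`.
  refine ⟨Real.exp (-(q * (1 - Real.log (1 - α)))), Real.exp_pos _, fun T m j hj => ?_⟩
  set τ := Real.exp (-(q * (1 - Real.log (1 - α))))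
  have hlenf := (T.map f hmono).len_pos m (j / 2)
  have hexp := Real.add_one_le_exp (-τ)
  suffices h : (T.map f hmono).len (m + 1) j ≤ (1 - τ) * (T.map f hmono).len m (j / 2) from
    h.trans (mul_le_mul_of_nonneg_right (by linarith) hlenf.le)
  have hα' : 0 < 1 - α := by linarith
  rcases Nat.even_or_odd' j with ⟨i, rfl | rfl⟩
  · rw [show 2 * i / 2 = i by omega] at *
    have h1 := T.hi_lt_lo m i
    have h2 := T.lo_lt_hi (m + 1) (2 * i + 1)
    have h3 := T.hi_right m i
    have h4 := T.lo_left m i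
    have h5 := T.lo_lt_hi (m + 1) (2 * i)
    have h6 := hlow (T.lo m i) (T.hi (m + 1) (2 * i)) (T.hi m i) (T.hi m i) (1 - α)
      (by linarith) (by linarith) le_rfl hα' (by unfold len at hj; linarith)
    have h7 : f (T.lo (m + 1) (2 * i)) = f (T.lo m i) := by rw [h4]
    simp only [len, map]
    linarith
  · rw [show (2 * i + 1) / 2 = i by omega] at *
    have h1 := T.hi_lt_lo m i
    have h2 := T.lo_lt_hi (m + 1) (2 * i)
    have h3 := T.hi_right m i
    have h4 := T.lo_left m i
    have h5 := T.lo_lt_hi (m + 1) (2 * i + 1)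
    have h6 := hlow (T.lo m i) (T.lo m i) (T.lo (m + 1) (2 * i + 1)) (T.hi m i) (1 - α)
      le_rfl (by linarith) (by linarith) hα' (by unfold len at hj; linarith)
    have h7 : f (T.hi (m + 1) (2 * i + 1)) = f (T.hi m i) := by rw [h3]
    simp only [len, map]
    linarith

/-- A binary tree of intervals with a single root whose gaps are small on average, whose children
are not too small, and in which the children are a definite proportion shorter than their parent in
a positive proportion of the generations: increasing quasisymmetric maps send its limit set to a set
of dimension one. -/
theorem one_le_dimH_image_limitSet (T : IntervalTree) {f : ℝ ≃ₜ ℝ} (hf : IsQuasisymmetric f)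
    (hmono : StrictMono f) (hlo0 : ∀ j, T.lo 0 j = T.lo 0 0) (hhi0 : ∀ j, T.hi 0 j = T.hi 0 0)
    {β Γ κ γ : ℕ → ℝ} {α c D : ℝ}
    (hβ : ∀ m j, T.gap m j ≤ β m * T.len m j)
    (hβ0 : Tendsto (fun m : ℕ => (1 / (m : ℝ)) * ∑ i ∈ Finset.range m, β i) atTop (𝓝 0))
    (hΓ : ∀ m, 0 < Γ m) (hgΓ : ∀ m j, T.gap m j ≤ (1 - Γ m) * T.len m j)
    (hΓ0 : Tendsto (fun m : ℕ => (1 / (m : ℝ)) * ∑ i ∈ Finset.range m, Real.log (Γ i))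
      atTop (𝓝 0))
    (hκ : ∀ m, 0 < κ m) (hκl : ∀ m j, κ m * T.len m (j / 2) ≤ T.len (m + 1) j)
    (hκ0 : Tendsto (fun m : ℕ => (1 / (m : ℝ)) * Real.log (κ m)) atTop (𝓝 0))
    (hα : α < 1) (hc : 0 < c) (hγ : ∀ m j, T.len (m + 1) j ≤ γ m * T.len m (j / 2))
    (hγc : ∀ m : ℕ, c * m - D ≤ (({i ∈ Finset.range m | γ i ≤ α} : Finset ℕ).card : ℝ)) :
    1 ≤ dimH (f '' T.limitSet) := by
  set T' := T.map f hmono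
  suffices h : ∀ d : ℝ, 0 < d → d < 1 → ENNReal.ofReal d ≤ dimH T'.limitSet by
    refine le_trans ?_ (dimH_mono (T.limitSet_map_subset f hmono))
    refine le_of_forall_lt fun a ha => ?_
    obtain ⟨b, hab, hb⟩ := exists_between ha
    have hbt : b ≠ ⊤ := (hb.trans ENNReal.one_lt_top).ne
    have hb0 : 0 < b := (zero_le).trans_lt hab
    have := h b.toReal (ENNReal.toReal_pos hb0.ne' hbt)
      (by simpa using (ENNReal.toReal_lt_toReal hbt ENNReal.one_ne_top).2 hb)
    rw [ENNReal.ofReal_toReal hbt] at this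
    exact hab.trans_le this
  intro d hd hd1
  obtain ⟨τ, hτ, hshort⟩ := exists_map_len_le hf hmono hα
  -- Lengths decay like `exp (-τ c m)`, so their power `1 - d` gains `δ m` in the exponent. Half of
  -- `δ` serves as `ε` in the loss per generation, the other half absorbs the `o(m)` remainder `u`.
  set δ := (1 - d) * (τ * c)
  have hδ : 0 < δ := mul_pos (by linarith) (mul_pos hτ hc)
  obtain ⟨A, q, hA, hq, hsum⟩ := exists_map_len_add_ge hf hmono (half_pos hδ)
  obtain ⟨η, p, hp, -, -, -, hlow⟩ := hf.exists_distortion hmono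
  set l := T'.len 0 0
  have hl : 0 < l := T'.len_pos 0 0
  -- The estimates do not impose `j < 2 ^ m`, so all roots `(0, j)` have to be alike.
  have hl0 : ∀ j, T'.len 0 j = l := fun j => by
    simp only [l, T', len, map, hlo0 j, hhi0 j]
  have hcard : ∀ m j, T'.len m j ≤
      l * Real.exp (-(τ * ({i ∈ Finset.range m | γ i ≤ α} : Finset ℕ).card)) := by
    intro m
    induction m with
    | zero => intro j; simp [hl0]
    | succ m ih =>
      intro j
      rw [Finset.range_add_one, Finset.filter_insert]
      have h1 := ih (j / 2)
      split_ifs with h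
      · rw [Finset.card_insert_of_notMem (by simp)]
        have h2 := hshort T m j ((hγ m j).trans
          (mul_le_mul_of_nonneg_right h (T.len_pos _ _).le))
        refine h2.trans ((mul_le_mul_of_nonneg_left h1 (Real.exp_pos _).le).trans_eq ?_)
        rw [mul_left_comm, ← Real.exp_add]
        push_cast
        ring_nf
      · refine le_trans ?_ h1
        exact sub_le_sub (hmono.monotone (T.hi_le_parent m j)) (hmono.monotone (T.lo_parent_le m j))
  have hM : ∀ m j, T'.len m j ≤ l * Real.exp (τ * D - τ * c * m) := fun m j => by
    refine (hcard m j).trans (mul_le_mul_of_nonneg_left (Real.exp_le_exp.2 ?_) hl.le)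
    nlinarith [hγc m]
  set u : ℕ → ℝ := fun m => A * ∑ i ∈ Finset.range m, β i -
    q * ∑ i ∈ Finset.range m, Real.log (Γ i) - d * p * Real.log (κ m)
  have hu : Tendsto (fun m : ℕ => (1 / (m : ℝ)) * u m) atTop (𝓝 0) := by
    have := ((hβ0.const_mul A).sub (hΓ0.const_mul q)).sub (hκ0.const_mul (d * p))
    simp only [mul_zero, sub_zero] at this
    refine this.congr fun m => ?_
    simp only [u]
    ring
  obtain ⟨B, hB⟩ := exists_le_mul_add_of_tendsto_avg hu (half_pos hδ)
  refine T'.le_dimH_limitSet_of_len hd hd1.le hl (fun j => (hl0 j).ge)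
    (B := Real.exp ((1 - d) * (Real.log l + τ * D) + B + d * p)) (Real.exp_pos _).le
    (g := fun m => Real.exp (-(δ / 2 + A * β m - q * Real.log (Γ m))))
    (κ := fun m => Real.exp (-(p * (1 - Real.log (κ m)))))
    (M := fun m => l * Real.exp (τ * D - τ * c * m))
    (fun m => Real.exp_pos _) (fun m => Real.exp_pos _)
    (fun m j => hsum T m j (β m) (Γ m) (hβ m j) (hΓ m) (hgΓ m j)) (fun m j => ?_) (fun m j => ?_)
    hM ?_ fun m => ?_
  · have h1 := T.hi_lt_lo m j
    have h2 := T.lo_lt_hi (m + 1) (2 * j + 1)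
    have h3 := T.hi_right m j
    have h4 := hκl m (2 * j)
    rw [show 2 * j / 2 = j by omega] at h4
    exact hlow (T.lo m j) (T.lo (m + 1) (2 * j)) (T.hi (m + 1) (2 * j)) (T.hi m j) (κ m)
      (T.lo_left m j).ge (T.lo_lt_hi _ _) (by linarith) (hκ m) h4
  · have h1 := T.hi_lt_lo m j
    have h2 := T.lo_lt_hi (m + 1) (2 * j)
    have h3 := T.lo_left m j
    have h4 := hκl m (2 * j + 1)
    rw [show (2 * j + 1) / 2 = j by omega] at h4
    exact hlow (T.lo m j) (T.lo (m + 1) (2 * j + 1)) (T.hi (m + 1) (2 * j + 1)) (T.hi m j) (κ m)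
      (by linarith) (T.lo_lt_hi _ _) (T.hi_right m j).le (hκ m) h4
  · have h1 : Tendsto (fun m : ℕ => τ * c * (m : ℝ)) atTop atTop :=
      tendsto_natCast_atTop_atTop.const_mul_atTop (mul_pos hτ hc)
    have h2 : Tendsto (fun m : ℕ => τ * D - τ * c * (m : ℝ)) atTop atBot := by
      simpa [sub_eq_add_neg] using
        tendsto_atBot_add_const_left atTop (τ * D) (tendsto_neg_atTop_atBot.comp h1)
    simpa using (Real.tendsto_exp_atBot.comp h2).const_mul l
  · have h1 := hB m
    simp only [u] at h1
    rw [← Real.exp_sum, ← Real.exp_mul, ← Real.exp_add, ← Real.exp_add]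
    conv_lhs => rw [← Real.exp_log hl, ← Real.exp_add, ← Real.exp_mul]
    apply Real.exp_le_exp.2
    rw [Finset.sum_neg_distrib, Finset.sum_sub_distrib, Finset.sum_add_distrib, ← Finset.mul_sum,
      ← Finset.mul_sum, Finset.sum_const, Finset.card_range, nsmul_eq_mul]
    simp only [δ] at h1 ⊢
    linarith

end IntervalTree

/-! ### Reading the quantities of a system off a tree -/

namespace IntervalTree

variable (T : IntervalTree)

/-- The intervals of generation `m` below the root `(0, 0)`. -/
def family (m : ℕ) : Set (Set ℝ) := {I | ∃ j < 2 ^ m, I = Icc (T.lo m j) (T.hi m j)}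

lemma sUnion_family (m : ℕ) : ⋃₀ T.family m = T.level m := by
  ext x
  constructor
  · rintro ⟨_, ⟨j, hj, rfl⟩, hx⟩
    exact ⟨j, hj, hx⟩
  · rintro ⟨j, hj, hx⟩
    exact ⟨_, ⟨j, hj, rfl⟩, hx⟩

lemma level_antitone : Antitone T.level := by
  refine antitone_nat_of_succ_le fun m => ?_
  rintro x ⟨j, hj, h1, h2⟩
  rw [pow_succ] at hj
  exact ⟨j / 2, by omega, (T.lo_parent_le m j).trans h1, h2.trans (T.hi_le_parent m j)⟩

lemma hi_lt_lo_of_lt {m j i : ℕ} (hji : j < i) (hi : i < 2 ^ m) : T.hi m j < T.lo m i := by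
  induction m generalizing j i with
  | zero => rw [pow_zero] at hi; omega
  | succ m ih =>
    rw [pow_succ] at hi
    rcases (Nat.div_le_div_right (c := 2) hji.le).lt_or_eq with h | h
    · exact (T.hi_le_parent m j).trans_lt ((ih h (by omega)).trans_le (T.lo_parent_le m i))
    · have hj : j = 2 * (j / 2) := by omega
      have hi' : i = 2 * (j / 2) + 1 := by omega
      rw [hj, hi']
      exact T.hi_lt_lo m (j / 2)

lemma index_eq {m j i : ℕ} {x : ℝ} (hj : j < 2 ^ m) (hi : i < 2 ^ m)
    (hxj : x ∈ Icc (T.lo m j) (T.hi m j)) (hxi : x ∈ Icc (T.lo m i) (T.hi m i)) : j = i := by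
  rcases lt_trichotomy j i with h | h | h
  · linarith [T.hi_lt_lo_of_lt h hi, hxj.2, hxi.1]
  · exact h
  · linarith [T.hi_lt_lo_of_lt h hj, hxi.2, hxj.1]

lemma child_subset (m j : ℕ) :
    Icc (T.lo (m + 1) j) (T.hi (m + 1) j) ⊆ Icc (T.lo m (j / 2)) (T.hi m (j / 2)) :=
  Icc_subset_Icc (T.lo_parent_le m j) (T.hi_le_parent m j)

lemma eq_parent {m j i : ℕ} (hj : j < 2 ^ (m + 1)) (hi : i < 2 ^ m)
    (h : Icc (T.lo (m + 1) j) (T.hi (m + 1) j) ⊆ Icc (T.lo m i) (T.hi m i)) : j / 2 = i := by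
  have hx : T.lo (m + 1) j ∈ Icc (T.lo (m + 1) j) (T.hi (m + 1) j) :=
    left_mem_Icc.2 (T.lo_lt_hi _ _).le
  rw [pow_succ] at hj
  exact T.index_eq (by omega) hi (T.child_subset m j hx) (h hx)

/-- The children reach the outer endpoints, so the next generation leaves a single component: the
central gap. -/
lemma diff_level {m j : ℕ} (hj : j < 2 ^ m) : Icc (T.lo m j) (T.hi m j) \ T.level (m + 1) =
    Ioo (T.hi (m + 1) (2 * j)) (T.lo (m + 1) (2 * j + 1)) := by
  have e1 := T.lo_left m j
  have e2 := T.hi_right m j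
  have h1 := T.lo_lt_hi (m + 1) (2 * j)
  have h2 := T.lo_lt_hi (m + 1) (2 * j + 1)
  have hp : 2 ^ (m + 1) = 2 ^ m * 2 := pow_succ 2 m
  ext x
  constructor
  · rintro ⟨⟨hx1, hx2⟩, hx⟩
    constructor
    · by_contra! h
      exact hx ⟨2 * j, by omega, by linarith, h⟩
    · by_contra! h
      exact hx ⟨2 * j + 1, by omega, h, by linarith⟩
  · rintro ⟨hx1, hx2⟩
    refine ⟨⟨by linarith, by linarith⟩, ?_⟩
    rintro ⟨i, hi, hxi⟩
    have h3 := T.index_eq hj (by omega) (by constructor <;> linarith) (T.child_subset m i hxi)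
    obtain rfl | rfl : i = 2 * j ∨ i = 2 * j + 1 := by omega
    · linarith [hxi.2]
    · linarith [hxi.1]

lemma volume_Icc (m j : ℕ) : volume.real (Icc (T.lo m j) (T.hi m j)) = T.len m j := by
  rw [Real.volume_real_Icc_of_le (T.lo_lt_hi m j).le, len]

end IntervalTree

namespace HomogeneousPerfect.System

variable {n : ℕ → ℕ} {c : ℕ → ℝ} {η : ℕ → ℕ → ℝ} {H : System n c η} {T : IntervalTree}

lemma F_eq_level (hH : ∀ m, H.basic m = T.family m) (m : ℕ) : H.F m = T.level m := by
  rw [F, hH, T.sUnion_family]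

lemma beta_eq (hH : ∀ m, H.basic m = T.family m) (m : ℕ) :
    H.beta m = sSup ((fun j => T.gap m j / T.len m j) '' Iio (2 ^ m)) := by
  rw [beta]
  congr 1
  have key : ∀ j < 2 ^ m, ∀ x ∈ Icc (T.lo m j) (T.hi m j) \ H.F (m + 1),
      volume.real (connectedComponentIn (Icc (T.lo m j) (T.hi m j) \ H.F (m + 1)) x) =
        T.gap m j := by
    intro j hj x hx
    rw [F_eq_level hH, T.diff_level hj] at *
    rw [isPreconnected_Ioo.connectedComponentIn hx, Real.volume_real_Ioo_of_le (T.hi_lt_lo m j).le,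
      IntervalTree.gap]
  ext r
  constructor
  · rintro ⟨_, hI, x, hx, rfl⟩
    rw [hH] at hI
    obtain ⟨j, hj, rfl⟩ := hI
    exact ⟨j, hj, by rw [key j hj x hx, T.volume_Icc]⟩
  · rintro ⟨j, hj, rfl⟩
    obtain ⟨x, hx⟩ := exists_between (T.hi_lt_lo m j)
    have hx' : x ∈ Icc (T.lo m j) (T.hi m j) \ H.F (m + 1) := by
      rw [F_eq_level hH, T.diff_level hj]
      exact hx
    refine ⟨_, by rw [hH]; exact ⟨j, hj, rfl⟩, x, hx', ?_⟩
    rw [key j hj x hx', T.volume_Icc]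

lemma childLength_eq (hH : ∀ m, H.basic m = T.family m) {m j : ℕ} (hj : j < 2 ^ m) :
    H.childLength m (Icc (T.lo m j) (T.hi m j)) = T.len m j - T.gap m j := by
  have hp : 2 ^ (m + 1) = 2 ^ m * 2 := pow_succ 2 m
  have hset : {I : Set ℝ | I ∈ H.basic (m + 1) ∧ I ⊆ Icc (T.lo m j) (T.hi m j)} =
      {Icc (T.lo (m + 1) (2 * j)) (T.hi (m + 1) (2 * j)),
        Icc (T.lo (m + 1) (2 * j + 1)) (T.hi (m + 1) (2 * j + 1))} := by
    ext I
    rw [hH]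
    constructor
    · rintro ⟨⟨i, hi, rfl⟩, hI⟩
      have := T.eq_parent hi hj hI
      obtain rfl | rfl : i = 2 * j ∨ i = 2 * j + 1 := by omega
      · exact Or.inl rfl
      · exact Or.inr rfl
    · rintro (rfl | rfl)
      · refine ⟨⟨2 * j, by omega, rfl⟩, ?_⟩
        have := T.child_subset m (2 * j)
        rwa [show 2 * j / 2 = j by omega] at this
      · refine ⟨⟨2 * j + 1, by omega, rfl⟩, ?_⟩
        have := T.child_subset m (2 * j + 1)
        rwa [show (2 * j + 1) / 2 = j by omega] at this
  have hne : Icc (T.lo (m + 1) (2 * j)) (T.hi (m + 1) (2 * j)) ≠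
      Icc (T.lo (m + 1) (2 * j + 1)) (T.hi (m + 1) (2 * j + 1)) := by
    intro h
    have h1 : T.hi (m + 1) (2 * j) ∈ Icc (T.lo (m + 1) (2 * j)) (T.hi (m + 1) (2 * j)) :=
      right_mem_Icc.2 (T.lo_lt_hi _ _).le
    rw [h] at h1
    linarith [h1.1, T.hi_lt_lo m j]
  rw [childLength, hset, finsum_mem_pair hne, T.volume_Icc, T.volume_Icc]
  linarith [T.len_eq m j]

lemma bigGamma_eq (hH : ∀ m, H.basic m = T.family m) (m : ℕ) :
    H.bigGamma m = sInf ((fun j => 1 - T.gap m j / T.len m j) '' Iio (2 ^ m)) := by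
  rw [bigGamma]
  congr 1
  have key : ∀ j < 2 ^ m, H.childLength m (Icc (T.lo m j) (T.hi m j)) /
      volume.real (Icc (T.lo m j) (T.hi m j)) = 1 - T.gap m j / T.len m j := fun j hj => by
    rw [childLength_eq hH hj, T.volume_Icc, sub_div, div_self (T.len_pos m j).ne']
  ext r
  constructor
  · rintro ⟨_, hI, rfl⟩
    rw [hH] at hI
    obtain ⟨j, hj, rfl⟩ := hI
    exact ⟨j, hj, (key j hj).symm⟩
  · rintro ⟨j, hj, rfl⟩
    exact ⟨_, by rw [hH]; exact ⟨j, hj, rfl⟩, (key j hj).symm⟩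

lemma smallGamma_succ_eq (hH : ∀ m, H.basic m = T.family m) (m : ℕ) : H.smallGamma (m + 1) =
    sSup ((fun j => T.len (m + 1) j / T.len m (j / 2)) '' Iio (2 ^ (m + 1))) := by
  rw [smallGamma]
  congr 1
  ext r
  constructor
  · rintro ⟨_, hJ, _, hI, hJI, rfl⟩
    rw [hH] at hJ hI
    obtain ⟨j, hj, rfl⟩ := hJ
    obtain ⟨i, hi, rfl⟩ := hI
    obtain rfl := T.eq_parent hj hi hJI
    exact ⟨j, hj, by rw [T.volume_Icc, T.volume_Icc, Nat.add_sub_cancel]⟩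
  · rintro ⟨j, hj, rfl⟩
    have hj' : j < 2 ^ (m + 1) := hj
    rw [pow_succ] at hj'
    exact ⟨_, by rw [hH]; exact ⟨j, hj, rfl⟩, Icc (T.lo m (j / 2)) (T.hi m (j / 2)),
      by rw [hH]; exact ⟨j / 2, by change j / 2 < 2 ^ m; omega, rfl⟩, T.child_subset m j,
      by simp only [T.volume_Icc]⟩

lemma volume_image_basic (hH : ∀ m, H.basic m = T.family m) (m : ℕ) :
    volume.real '' H.basic m = T.len m '' Iio (2 ^ m) := by
  rw [hH]
  ext r
  constructor
  · rintro ⟨_, ⟨j, hj, rfl⟩, rfl⟩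
    exact ⟨j, hj, (T.volume_Icc m j).symm⟩
  · rintro ⟨j, hj, rfl⟩
    exact ⟨_, ⟨j, hj, rfl⟩, T.volume_Icc m j⟩

lemma beta_nonneg (hH : ∀ m, H.basic m = T.family m) (m : ℕ) : 0 ≤ H.beta m := by
  rw [beta_eq hH]
  apply Real.sSup_nonneg
  rintro _ ⟨j, -, rfl⟩
  exact div_nonneg (T.gap_pos m j).le (T.len_pos m j).le

lemma beta_le (hH : ∀ m, H.basic m = T.family m) {m : ℕ} {b : ℝ}
    (hb : ∀ j, T.gap m j ≤ b * T.len m j) : H.beta m ≤ b := by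
  rw [beta_eq hH]
  refine csSup_le (Set.Nonempty.image _ ⟨0, by simp⟩) ?_
  rintro _ ⟨j, -, rfl⟩
  exact (div_le_iff₀ (T.len_pos m j)).2 (hb j)

lemma bigGamma_le_one (hH : ∀ m, H.basic m = T.family m) (m : ℕ) : H.bigGamma m ≤ 1 := by
  rw [bigGamma_eq hH]
  refine (csInf_le ((Set.finite_Iio _).image _).bddBelow ⟨0, by simp, rfl⟩).trans ?_
  have := div_nonneg (T.gap_pos m 0).le (T.len_pos m 0).le
  linarith

lemma le_bigGamma (hH : ∀ m, H.basic m = T.family m) {m : ℕ} {g : ℝ}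
    (hg : ∀ j, T.gap m j ≤ (1 - g) * T.len m j) : g ≤ H.bigGamma m := by
  rw [bigGamma_eq hH]
  refine le_csInf (Set.Nonempty.image _ ⟨0, by simp⟩) ?_
  rintro _ ⟨j, -, rfl⟩
  have := (div_le_iff₀ (T.len_pos m j)).2 (hg j)
  simp only
  linarith

lemma smallGamma_succ_le (hH : ∀ m, H.basic m = T.family m) {m : ℕ} {a : ℝ}
    (ha : ∀ j, T.len (m + 1) j ≤ a * T.len m (j / 2)) : H.smallGamma (m + 1) ≤ a := by
  rw [smallGamma_succ_eq hH]
  refine csSup_le (Set.Nonempty.image _ ⟨0, by simp⟩) ?_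
  rintro _ ⟨j, -, rfl⟩
  exact (div_le_iff₀ (T.len_pos m _)).2 (ha j)

end HomogeneousPerfect.System

/-! ### Lengths and gaps of blocks in the example -/

namespace HomogeneousPerfect

/-- The excess, in units of `δ_k`, of the exceptional gap `η_{k, l_k}` over the other gaps. -/
noncomputable def exX (k : ℕ) : ℝ := 1 + (k : ℝ) * Real.sqrt 2 ^ k

/-- The distance from the left endpoint of an interval of order `k - 1` to its subinterval of
number `r + 1`. -/
noncomputable def exPos (k r : ℕ) : ℝ :=
  (2 * (r : ℝ) + if exL k ≤ r then exX k else 0) * prodC exC k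

lemma exX_pos (k : ℕ) : 0 < exX k := by unfold exX; positivity

lemma exC_pos (k : ℕ) : 0 < exC k := by unfold exC; positivity

lemma prodC_pos (k : ℕ) : 0 < prodC exC k := Finset.prod_pos fun i _ => exC_pos i

lemma prodC_zero : prodC exC 0 = 1 := by simp [prodC]

lemma prodC_succ (k : ℕ) : prodC exC (k + 1) = prodC exC k * exC (k + 1) := by
  rw [prodC, prodC, Finset.prod_Icc_succ_top (by omega)]

/-- The count behind it: `2 ^ (k + 1)` intervals, `2 ^ (k + 1) - 1` gaps of the same length and one
excess fill the parent exactly. -/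
lemma prodC_eq (k : ℕ) : prodC exC k = (2 * 2 ^ (k + 1) - 1 + exX (k + 1)) * prodC exC (k + 1) := by
  have h : (0 : ℝ) < 2 ^ (k + 1 + 1) + ((k + 1 : ℕ) : ℝ) * Real.sqrt 2 ^ (k + 1) := by positivity
  rw [prodC_succ, exC, exX, show (2 : ℝ) * 2 ^ (k + 1) - 1 + (1 + ((k + 1 : ℕ) : ℝ) *
    Real.sqrt 2 ^ (k + 1)) = 2 ^ (k + 1 + 1) + ((k + 1 : ℕ) : ℝ) * Real.sqrt 2 ^ (k + 1) by
      rw [pow_succ 2 (k + 1)]; ring]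
  field_simp

lemma exL_add {k : ℕ} : exL k + 2 ^ (k - k / 2 - 1) = 2 ^ k :=
  Nat.sub_add_cancel (Nat.pow_le_pow_right two_pos (by omega))

lemma exL_lt (k : ℕ) : exL k < 2 ^ k := by
  have := exL_add (k := k)
  have : 0 < 2 ^ (k - k / 2 - 1) := by positivity
  omega

lemma two_pow_le_exL (k : ℕ) : 2 ^ k ≤ exL (k + 1) := by
  have h1 := exL_add (k := k + 1)
  have h2 : 2 ^ (k + 1 - (k + 1) / 2 - 1) ≤ 2 ^ k := Nat.pow_le_pow_right two_pos (by omega)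
  rw [pow_succ] at h1
  omega

lemma exL_pos (k : ℕ) : 0 < exL (k + 1) := (Nat.two_pow_pos k).trans_le (two_pow_le_exL k)

lemma exPos_zero (k : ℕ) : exPos (k + 1) 0 = 0 := by
  have := exL_pos k
  rw [exPos, if_neg (by omega)]
  simp

lemma exPos_succ (k r : ℕ) : exPos k (r + 1) =
    exPos k r + (2 + if r + 1 = exL k then exX k else 0) * prodC exC k := by
  unfold exPos
  rcases lt_trichotomy (r + 1) (exL k) with h | h | h
  · rw [if_neg (by omega), if_neg (by omega), if_neg (by omega)]; push_cast; ring
  · rw [if_pos (by omega), if_neg (by omega), if_pos (by omega)]; push_cast; ring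
  · rw [if_pos (by omega), if_pos (by omega), if_neg (by omega)]; push_cast; ring

lemma exPos_last (k : ℕ) : exPos (k + 1) (2 ^ (k + 1) - 1) + prodC exC (k + 1) = prodC exC k := by
  have h1 := exL_lt (k + 1)
  have h2 : 0 < 2 ^ (k + 1) := by positivity
  rw [exPos, if_pos (by omega), prodC_eq k, Nat.cast_sub (by omega)]
  push_cast
  ring

/-- The left endpoint of the interval of order `k` and number `i` (from left to right). -/
noncomputable def exLo : ℕ → ℕ → ℝ
  -- All indices of order 0 give the same root, so larger indices only repeat the picture and later
  -- bounds need no restriction on the index.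
  | 0, _ => 0
  | k + 1, i => exLo k (i / 2 ^ (k + 1)) + exPos (k + 1) (i % 2 ^ (k + 1))

lemma exLo_add {k r : ℕ} (i : ℕ) (hr : r < 2 ^ (k + 1)) :
    exLo (k + 1) (i * 2 ^ (k + 1) + r) = exLo k i + exPos (k + 1) r := by
  rw [exLo, add_comm (i * _), Nat.add_mul_mod_self_right, Nat.mod_eq_of_lt hr,
    Nat.add_mul_div_right _ _ (by positivity), Nat.div_eq_of_lt hr, zero_add]

/-- Left endpoint of the block of number `j` of `2 ^ s` consecutive intervals of order `k`. -/
noncomputable def blockLo (k s j : ℕ) : ℝ := exLo k (j * 2 ^ s)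

/-- Right endpoint of the block of number `j` of `2 ^ s` consecutive intervals of order `k`. -/
noncomputable def blockHi (k s j : ℕ) : ℝ := exLo k ((j + 1) * 2 ^ s - 1) + prodC exC k

lemma blockLo_top (k j : ℕ) : blockLo (k + 1) (k + 1) j = exLo k j := by
  have := exLo_add (k := k) j (r := 0) (by positivity)
  rwa [exPos_zero, add_zero, add_zero] at this

lemma blockHi_top (k j : ℕ) : blockHi (k + 1) (k + 1) j = exLo k j + prodC exC k := by
  have h2 : 0 < 2 ^ (k + 1) := by positivity
  rw [blockHi, show (j + 1) * 2 ^ (k + 1) - 1 = j * 2 ^ (k + 1) + (2 ^ (k + 1) - 1) by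
    rw [add_mul]; omega, exLo_add j (by omega), add_assoc, exPos_last]

lemma blockLo_zero (k j : ℕ) : blockLo k 0 j = exLo k j := by simp [blockLo]

lemma blockHi_zero (k j : ℕ) : blockHi k 0 j = exLo k j + prodC exC k := by simp [blockHi]

lemma blockLo_left (k s j : ℕ) : blockLo k s (2 * j) = blockLo k (s + 1) j := by
  rw [blockLo, blockLo]; congr 1; ring

lemma blockHi_right (k s j : ℕ) : blockHi k s (2 * j + 1) = blockHi k (s + 1) j := by
  rw [blockHi, blockHi, show (2 * j + 1 + 1) * 2 ^ s = (j + 1) * 2 ^ (s + 1) by ring]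

/-- The length of a block of `2 ^ s` consecutive intervals. -/
lemma block_len {k s : ℕ} (hs : s ≤ k + 1) (j : ℕ) :
    blockHi (k + 1) s j - blockLo (k + 1) s j = (2 * 2 ^ s - 1 +
      if j % 2 ^ (k + 1 - s) * 2 ^ s < exL (k + 1) ∧
        exL (k + 1) < (j % 2 ^ (k + 1 - s) + 1) * 2 ^ s then exX (k + 1) else 0) *
      prodC exC (k + 1) := by
  -- `i` is the number of the parent of order `k` and `u` the position of the block in it; the
  -- excess counts when gap `l` lies strictly inside block `u`.
  set u := j % 2 ^ (k + 1 - s)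
  set i := j / 2 ^ (k + 1 - s)
  have hj : j = i * 2 ^ (k + 1 - s) + u := (Nat.div_add_mod' j _).symm
  have hu : u < 2 ^ (k + 1 - s) := Nat.mod_lt _ (by positivity)
  have hpow : 2 ^ (k + 1 - s) * 2 ^ s = 2 ^ (k + 1) := by rw [← pow_add]; congr 1; omega
  have hs0 : 0 < 2 ^ s := by positivity
  have hu2 : (u + 1) * 2 ^ s ≤ 2 ^ (k + 1) := by
    rw [← hpow]; exact Nat.mul_le_mul_right _ hu
  have hu3 : (u + 1) * 2 ^ s = u * 2 ^ s + 2 ^ s := by ring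
  have e1 : j * 2 ^ s = i * 2 ^ (k + 1) + u * 2 ^ s := by rw [hj, ← hpow]; ring
  have e2 : (j + 1) * 2 ^ s - 1 = i * 2 ^ (k + 1) + ((u + 1) * 2 ^ s - 1) := by
    rw [add_mul, e1]; omega
  rw [blockHi, blockLo, e1, e2, exLo_add i (by omega), exLo_add i (by omega), exPos, exPos,
    Nat.cast_sub (by omega)]
  push_cast
  by_cases h1 : exL (k + 1) ≤ u * 2 ^ s
  · rw [if_pos (by omega), if_pos h1, if_neg (by omega)]; ring
  · by_cases h2 : exL (k + 1) < (u + 1) * 2 ^ s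
    · rw [if_pos (by omega), if_neg h1, if_pos (by omega)]; ring
    · rw [if_neg (by omega), if_neg h1, if_neg (by omega)]; ring

/-- The gap in the middle of a block of `2 ^ (s + 1)` consecutive intervals. -/
lemma block_gap {k s : ℕ} (hs : s ≤ k) (j : ℕ) :
    blockLo (k + 1) s (2 * j + 1) - blockHi (k + 1) s (2 * j) =
      (1 + if (2 * j + 1) * 2 ^ s % 2 ^ (k + 1) = exL (k + 1) then exX (k + 1) else 0) *
        prodC exC (k + 1) := by
  set N := (2 * j + 1) * 2 ^ s
  have hN := Nat.div_add_mod' N (2 ^ (k + 1))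
  set i := N / 2 ^ (k + 1)
  -- An odd multiple of `2 ^ s` with `s ≤ k` is not a multiple of `2 ^ (k + 1)`, so the cut never
  -- falls between two parents.
  have hr0 : N % 2 ^ (k + 1) ≠ 0 := by
    intro h
    have h1 : 2 ^ (s + 1) ∣ N := (Nat.pow_dvd_pow 2 (by omega)).trans (Nat.dvd_of_mod_eq_zero h)
    rw [pow_succ', Nat.mul_dvd_mul_iff_right (by positivity)] at h1
    omega
  have hr1 : N % 2 ^ (k + 1) < 2 ^ (k + 1) := Nat.mod_lt _ (by positivity)
  obtain ⟨r, hr⟩ := Nat.exists_eq_succ_of_ne_zero hr0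
  rw [blockLo, blockHi]
  change exLo (k + 1) N - (exLo (k + 1) (N - 1) + _) = _
  rw [hr] at hN hr1 ⊢
  rw [Nat.succ_eq_add_one] at *
  rw [show N - 1 = i * 2 ^ (k + 1) + r by omega, ← hN, exLo_add i hr1, exLo_add i (by omega),
    exPos_succ]
  ring

/-- Compare powers of two: the cut is at an odd multiple of `2 ^ s`, while `l = 2 ^ (k + 1) - 2 ^ e`
with `e ≤ k` is divisible by `2 ^ e` but not by `2 ^ (e + 1)`. They can agree modulo `2 ^ (k + 1)`
only if `s = e`. -/
lemma block_gap_of_ne {k s : ℕ} (hs : s ≤ k) (hne : s ≠ k + 1 - (k + 1) / 2 - 1) (j : ℕ) :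
    blockLo (k + 1) s (2 * j + 1) - blockHi (k + 1) s (2 * j) = prodC exC (k + 1) := by
  rw [block_gap hs, if_neg, add_zero, one_mul]
  intro h
  have h1 := Nat.div_add_mod' ((2 * j + 1) * 2 ^ s) (2 ^ (k + 1))
  have h2 := exL_add (k := k + 1)
  rw [h] at h1
  set e := k + 1 - (k + 1) / 2 - 1
  set q := (2 * j + 1) * 2 ^ s / 2 ^ (k + 1)
  have h3 : (2 * j + 1) * 2 ^ s + 2 ^ e = (q + 1) * 2 ^ (k + 1) := by rw [← h1, add_mul]; omega
  rcases lt_or_gt_of_ne hne with hlt | hgt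
  · have h4 : 2 ^ (s + 1) ∣ (2 * j + 1) * 2 ^ s := by
      rw [← Nat.dvd_add_left (Nat.pow_dvd_pow 2 (by omega : s + 1 ≤ e)), h3]
      exact (Nat.pow_dvd_pow 2 (by omega)).mul_left _
    rw [pow_succ', Nat.mul_dvd_mul_iff_right (by positivity)] at h4
    omega
  · have h4 : 2 ^ (e + 1) ∣ 2 ^ e := by
      rw [← Nat.dvd_add_right ((Nat.pow_dvd_pow 2 (by omega : e + 1 ≤ s)).mul_left (2 * j + 1)), h3]
      exact (Nat.pow_dvd_pow 2 (by omega)).mul_left _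
    have := Nat.pow_dvd_pow_iff_le_right (x := 2) (by norm_num) |>.1 h4
    omega

lemma block_gap_pos {k s : ℕ} (hs : s ≤ k) (j : ℕ) :
    blockHi (k + 1) s (2 * j) < blockLo (k + 1) s (2 * j + 1) := by
  rw [← sub_pos, block_gap hs]
  have h1 := exX_pos (k + 1)
  have h2 := prodC_pos (k + 1)
  split_ifs <;> positivity

lemma block_len_ge {k s : ℕ} (hs : s ≤ k + 1) (j : ℕ) :
    2 ^ s * prodC exC (k + 1) ≤ blockHi (k + 1) s j - blockLo (k + 1) s j := by
  rw [block_len hs]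
  have h1 := exX_pos (k + 1)
  have h2 : (1 : ℝ) ≤ 2 ^ s := one_le_pow₀ one_le_two
  refine mul_le_mul_of_nonneg_right ?_ (prodC_pos _).le
  split_ifs <;> linarith

/-- For these `s` the power `2 ^ s` divides `l`, so the exceptional gap lies between two blocks and
never inside one. -/
lemma block_len_of_le {k s : ℕ} (hs : s ≤ k + 1 - (k + 1) / 2 - 1) (j : ℕ) :
    blockHi (k + 1) s j - blockLo (k + 1) s j = (2 * 2 ^ s - 1) * prodC exC (k + 1) := by
  rw [block_len (by omega), if_neg, add_zero]
  rintro ⟨h1, h2⟩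
  have h3 : 2 ^ s ∣ exL (k + 1) := by
    rw [← Nat.dvd_add_left (Nat.pow_dvd_pow 2 hs), exL_add]
    exact Nat.pow_dvd_pow 2 (by omega)
  obtain ⟨q, hq⟩ := h3
  rw [hq, mul_comm (2 ^ s) q] at h1 h2
  have h4 := Nat.lt_of_mul_lt_mul_right h1
  have h5 := Nat.lt_of_mul_lt_mul_right h2
  omega

lemma sqrt_two_pow_le {k s : ℕ} (h : k ≤ 2 * s) : Real.sqrt 2 ^ k ≤ 2 ^ s := by
  calc Real.sqrt 2 ^ k ≤ Real.sqrt 2 ^ (2 * s) :=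
        pow_le_pow_right₀ (Real.one_le_sqrt.2 one_le_two) h
    _ = 2 ^ s := by rw [pow_mul, Real.sq_sqrt zero_le_two]

/-- A block that contains the exceptional gap has `2 ^ s ≥ √2 ^ (k + 1)` intervals, so the excess
inflates its length only by a factor linear in `k`. -/
lemma block_len_le {k s : ℕ} (hs : s ≤ k + 1) (j : ℕ) :
    blockHi (k + 1) s j - blockLo (k + 1) s j ≤ (k + 3) * 2 ^ s * prodC exC (k + 1) := by
  have h2 : (0 : ℝ) < 2 ^ s := by positivity
  rcases le_or_gt s (k + 1 - (k + 1) / 2 - 1) with h | h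
  · rw [block_len_of_le h]
    refine mul_le_mul_of_nonneg_right ?_ (prodC_pos _).le
    nlinarith [(Nat.cast_nonneg k : (0 : ℝ) ≤ k)]
  · rw [block_len hs]
    refine mul_le_mul_of_nonneg_right ?_ (prodC_pos _).le
    have h3 : Real.sqrt 2 ^ (k + 1) ≤ 2 ^ s := sqrt_two_pow_le (by omega)
    have h4 : exX (k + 1) ≤ 1 + (k + 1) * 2 ^ s := by
      unfold exX
      push_cast
      gcongr
    have h5 := exX_pos (k + 1)
    split_ifs <;> nlinarith

end HomogeneousPerfect

/-! ### The tree of the example and its averages -/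

namespace HomogeneousPerfect

/-- Generation `m` consists of blocks of `2 ^ (r + 1)` consecutive intervals of order `k + 1`, where
`exStage m = (k, r)`. -/
def exStage : ℕ → ℕ × ℕ
  | 0 => (0, 0)
  | m + 1 => if (exStage m).2 = 0 then ((exStage m).1 + 1, (exStage m).1 + 1)
      else ((exStage m).1, (exStage m).2 - 1)

lemma exStage_snd_le (m : ℕ) : (exStage m).2 ≤ (exStage m).1 := by
  induction m with
  | zero => simp [exStage]
  | succ m ih =>
    rw [exStage]
    split_ifs
    · exact le_rfl
    · exact (Nat.sub_le _ _).trans ih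

/-- Stage `k` lasts `k + 1` generations. The resulting triangular number shows that `m` grows like
`k² / 2`. -/
lemma exStage_spec (m : ℕ) :
    2 * (m + (exStage m).2 + 1) = ((exStage m).1 + 1) * ((exStage m).1 + 2) := by
  induction m with
  | zero => simp [exStage]
  | succ m ih =>
    rw [exStage]
    split_ifs with h
    · rw [h] at ih
      simp only
      nlinarith
    · simp only
      rw [← ih]
      omega

lemma tendsto_exStage : Tendsto (fun m => (exStage m).1) atTop atTop := by
  refine tendsto_atTop.2 fun b => eventually_atTop.2 ⟨(b + 1) * (b + 2), fun m hm => ?_⟩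
  by_contra! h
  have h1 := exStage_spec m
  have h2 : ((exStage m).1 + 1) * ((exStage m).1 + 2) ≤ (b + 1) * (b + 2) :=
    Nat.mul_le_mul (by omega) (by omega)
  omega

/-- At a change of stage one interval has two descriptions: a single interval of order `k + 1`, and
the block of all its `2 ^ (k + 2)` subintervals. They agree because the outer gaps vanish. -/
lemma blockLo_exStage_succ (m j : ℕ) :
    blockLo ((exStage (m + 1)).1 + 1) ((exStage (m + 1)).2 + 1) j =
      blockLo ((exStage m).1 + 1) (exStage m).2 j := by
  rw [exStage]
  split_ifs with h
  · simp only [h, blockLo_top, blockLo_zero]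
  · simp only [Nat.sub_add_cancel (Nat.pos_of_ne_zero h)]

lemma blockHi_exStage_succ (m j : ℕ) :
    blockHi ((exStage (m + 1)).1 + 1) ((exStage (m + 1)).2 + 1) j =
      blockHi ((exStage m).1 + 1) (exStage m).2 j := by
  rw [exStage]
  split_ifs with h
  · simp only [h, blockHi_top, blockHi_zero]
  · simp only [Nat.sub_add_cancel (Nat.pos_of_ne_zero h)]

/-- The tree of basic intervals of the example. -/
noncomputable def exTree : IntervalTree where
  lo m j := blockLo ((exStage m).1 + 1) ((exStage m).2 + 1) j
  hi m j := blockHi ((exStage m).1 + 1) ((exStage m).2 + 1) j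
  lo_lt_hi m j := by
    have h1 := exStage_snd_le m
    have h2 := block_len_ge (k := (exStage m).1) (s := (exStage m).2 + 1) (by omega) j
    have h3 := prodC_pos ((exStage m).1 + 1)
    have h4 : 0 < (2 : ℝ) ^ ((exStage m).2 + 1) * prodC exC ((exStage m).1 + 1) := by positivity
    linarith
  lo_left m j := by rw [blockLo_exStage_succ, blockLo_left]
  hi_right m j := by rw [blockHi_exStage_succ, blockHi_right]
  hi_lt_lo m j := by
    rw [blockLo_exStage_succ, blockHi_exStage_succ]
    exact block_gap_pos (exStage_snd_le m) j

lemma exTree_len (m j : ℕ) : exTree.len m j =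
    blockHi ((exStage m).1 + 1) ((exStage m).2 + 1) j -
      blockLo ((exStage m).1 + 1) ((exStage m).2 + 1) j := rfl

lemma exTree_len_succ (m j : ℕ) : exTree.len (m + 1) j =
    blockHi ((exStage m).1 + 1) (exStage m).2 j - blockLo ((exStage m).1 + 1) (exStage m).2 j := by
  rw [exTree_len, blockLo_exStage_succ, blockHi_exStage_succ]

lemma exTree_gap (m j : ℕ) : exTree.gap m j =
    blockLo ((exStage m).1 + 1) (exStage m).2 (2 * j + 1) -
      blockHi ((exStage m).1 + 1) (exStage m).2 (2 * j) := by
  rw [← blockLo_exStage_succ, ← blockHi_exStage_succ]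
  rfl

/-- The index of the halving that cuts at the exceptional gap. -/
def exCrit (k : ℕ) : ℕ := k + 1 - (k + 1) / 2 - 1

/-- Lower bound for the proportion occupied by a child. -/
noncomputable def exKappa (m : ℕ) : ℝ := (2 * ((exStage m).1 + 3 : ℝ))⁻¹

/-- Upper bound for the proportion occupied by a gap and for minus the logarithm of the proportion
occupied by the children. -/
noncomputable def exLoss (m : ℕ) : ℝ := (1 / 2) ^ (exStage m).2 +
  if (exStage m).2 = exCrit (exStage m).1 then Real.log (2 * ((exStage m).1 + 3)) else 0

lemma exKappa_pos (m : ℕ) : 0 < exKappa m := by unfold exKappa; positivity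

lemma exKappa_mul_len_le (m j : ℕ) :
    exKappa m * exTree.len m (j / 2) ≤ exTree.len (m + 1) j := by
  have h1 := exStage_snd_le m
  have h2 := block_len_le (k := (exStage m).1) (s := (exStage m).2 + 1) (by omega) (j / 2)
  have h3 := block_len_ge (k := (exStage m).1) (s := (exStage m).2) (by omega) j
  rw [exTree_len_succ, exTree_len, exKappa]
  refine le_trans ?_ h3
  rw [inv_mul_le_iff₀ (by positivity)]
  refine h2.trans_eq ?_
  rw [pow_succ]
  ring

lemma log_stage_ge_one (k : ℕ) : 1 ≤ Real.log (2 * ((k : ℝ) + 3)) := by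
  rw [Real.le_log_iff_exp_le (by positivity)]
  linarith [Real.exp_one_lt_d9, (Nat.cast_nonneg k : (0 : ℝ) ≤ k)]

lemma exLoss_nonneg (m : ℕ) : 0 ≤ exLoss m := by
  have := log_stage_ge_one (exStage m).1
  unfold exLoss
  split_ifs <;> positivity

lemma exTree_gap_le_of_ne {m : ℕ} (h : (exStage m).2 ≠ exCrit (exStage m).1) (j : ℕ) :
    exTree.gap m j ≤ (1 / 2) ^ ((exStage m).2 + 1) * exTree.len m j := by
  have h1 := exStage_snd_le m
  have h3 := block_len_ge (k := (exStage m).1) (s := (exStage m).2 + 1) (by omega) j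
  rw [exTree_gap, block_gap_of_ne h1 h, exTree_len]
  calc prodC exC ((exStage m).1 + 1) = (1 / 2) ^ ((exStage m).2 + 1) *
        (2 ^ ((exStage m).2 + 1) * prodC exC ((exStage m).1 + 1)) := by
        rw [← mul_assoc, ← mul_pow]; norm_num
    _ ≤ _ := mul_le_mul_of_nonneg_left h3 (by positivity)

lemma exTree_gap_le (m j : ℕ) : exTree.gap m j ≤ exLoss m * exTree.len m j := by
  have hlen := exTree.len_pos m j
  by_cases h : (exStage m).2 = exCrit (exStage m).1
  · have h1 := log_stage_ge_one (exStage m).1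
    have h2 : 1 ≤ exLoss m := by
      have : (0 : ℝ) < (1 / 2) ^ (exStage m).2 := by positivity
      rw [exLoss, if_pos h]
      linarith
    have h3 := exTree.len_eq m j
    have h4 := exTree.len_pos (m + 1) (2 * j)
    have h5 := exTree.len_pos (m + 1) (2 * j + 1)
    nlinarith
  · refine (exTree_gap_le_of_ne h j).trans (mul_le_mul_of_nonneg_right ?_ hlen.le)
    have : (0 : ℝ) < (1 / 2) ^ (exStage m).2 := by positivity
    rw [exLoss, if_neg h, pow_succ]
    linarith

lemma exTree_gap_le_one_sub (m j : ℕ) :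
    exTree.gap m j ≤ (1 - Real.exp (-exLoss m)) * exTree.len m j := by
  have hlen := exTree.len_pos m j
  by_cases h : (exStage m).2 = exCrit (exStage m).1
  · have h0 := exKappa_mul_len_le m (2 * j)
    rw [show 2 * j / 2 = j by omega] at h0
    have h1 : Real.exp (-exLoss m) ≤ exKappa m := by
      have : (0 : ℝ) < (1 / 2) ^ (exStage m).2 := by positivity
      have h2 : (0 : ℝ) < 2 * ((exStage m).1 + 3) := by positivity
      calc Real.exp (-exLoss m) ≤ Real.exp (-Real.log (2 * ((exStage m).1 + 3))) := by
            rw [exLoss, if_pos h]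
            exact Real.exp_le_exp.2 (by linarith)
        _ = exKappa m := by rw [Real.exp_neg, Real.exp_log h2, exKappa]
    have h3 := exTree.len_eq m j
    have h5 := exTree.len_pos (m + 1) (2 * j + 1)
    have h6 := mul_le_mul_of_nonneg_right h1 hlen.le
    linarith
  · refine (exTree_gap_le_of_ne h j).trans (mul_le_mul_of_nonneg_right ?_ hlen.le)
    rw [exLoss, if_neg h, add_zero]
    -- `y` bounds the proportion of the gap and the loss is `2 * y`; for `y ≤ 1 / 2` one has `exp
    -- (-2 * y) ≤ 1 - y`.
    set y : ℝ := (1 / 2) ^ ((exStage m).2 + 1)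
    have hy : (1 / 2 : ℝ) ^ (exStage m).2 = 2 * y := by simp only [y]; rw [pow_succ]; ring
    have hy0 : 0 < y := by positivity
    have hy1 : y ≤ 1 / 2 := by
      have : (1 / 2 : ℝ) ^ (exStage m).2 ≤ 1 := pow_le_one₀ (by norm_num) (by norm_num)
      linarith
    rw [hy, Real.exp_neg]
    have h1 := Real.add_one_le_exp (2 * y)
    have h2 : (Real.exp (2 * y))⁻¹ ≤ 1 - y := by
      rw [inv_le_iff_one_le_mul₀ (Real.exp_pos _)]
      nlinarith
    linarith

lemma exTree_len_succ_le {m : ℕ} (h : (exStage m).2 < exCrit (exStage m).1) (j : ℕ) :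
    exTree.len (m + 1) j ≤ 1 / 2 * exTree.len m (j / 2) := by
  unfold exCrit at h
  rw [exTree_len_succ, exTree_len, block_len_of_le (by omega), block_len_of_le (by omega)]
  have := prodC_pos ((exStage m).1 + 1)
  rw [pow_succ]
  nlinarith

/-- Upper bound for the proportion occupied by a child. -/
noncomputable def exRatio (m : ℕ) : ℝ :=
  if (exStage m).2 < exCrit (exStage m).1 then 1 / 2 else 1

lemma exTree_len_succ_le_exRatio (m j : ℕ) :
    exTree.len (m + 1) j ≤ exRatio m * exTree.len m (j / 2) := by
  unfold exRatio
  split_ifs with h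
  · exact exTree_len_succ_le h j
  · have h1 := exTree.lo_parent_le m j
    have h2 := exTree.hi_le_parent m j
    unfold IntervalTree.len
    linarith

lemma exRatio_le_iff (m : ℕ) : exRatio m ≤ 1 / 2 ↔ (exStage m).2 < exCrit (exStage m).1 := by
  unfold exRatio
  split_ifs with h
  · simp [h]
  · simp only [h, iff_false]; norm_num

/-- Stage `k` has `exCrit k = ⌊k / 2⌋` generations of ratio `1 / 2`, about `k² / 4` over all earlier
stages; `3 * k` absorbs the rounding. The truncated difference counts those already passed in the
current stage. -/
lemma card_exRatio_aux (m : ℕ) :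
    (exStage m).1 * (exStage m).1 + 4 * (exCrit (exStage m).1 - 1 - (exStage m).2) ≤
      4 * ({i ∈ Finset.range m | exRatio i ≤ 1 / 2} : Finset ℕ).card + 3 * (exStage m).1 := by
  induction m with
  | zero => simp [exStage, exCrit]
  | succ m ih =>
    have hR := exRatio_le_iff m
    rw [Finset.range_add_one, Finset.filter_insert, exStage]
    set N := ({i ∈ Finset.range m | exRatio i ≤ 1 / 2} : Finset ℕ).card
    generalize exStage m = p at *
    obtain ⟨k, r⟩ := p
    simp only at ih hR ⊢
    have hk : exCrit (k + 1) - 1 - (k + 1) = 0 := by unfold exCrit; omega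
    have hc : k ≤ 2 * exCrit k + 1 := by unfold exCrit; omega
    have hsq : (k + 1) * (k + 1) = k * k + 2 * k + 1 := by ring
    split_ifs with h1 h2 h2 <;> rw [hR] at h2
    · rw [Finset.card_insert_of_notMem (by simp)]
      change _ ≤ 4 * (N + 1) + _
      simp only
      omega
    · change _ ≤ 4 * N + _
      simp only
      omega
    · rw [Finset.card_insert_of_notMem (by simp)]
      change _ ≤ 4 * (N + 1) + _
      simp only
      omega
    · change _ ≤ 4 * N + _
      simp only
      omega

lemma card_exRatio_ge (m : ℕ) : 1 / 4 * (m : ℝ) - 3 ≤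
    (({i ∈ Finset.range m | exRatio i ≤ 1 / 2} : Finset ℕ).card : ℝ) := by
  have h1 := card_exRatio_aux m
  have h2 := exStage_spec m
  set N := ({i ∈ Finset.range m | exRatio i ≤ 1 / 2} : Finset ℕ).card
  set k := (exStage m).1
  have h3 : (k : ℝ) * k ≤ 4 * N + 3 * k := by exact_mod_cast (Nat.le_add_right _ _).trans h1
  have h4 : 2 * (m : ℝ) ≤ (k + 1) * (k + 2) := by
    exact_mod_cast (by omega : 2 * m ≤ (k + 1) * (k + 2))
  -- Combining `h3` and `h4` leaves `k² - 9 k + 22 ≥ 0`, whose left side is smallest at `9 / 2`;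
  -- this is where the 3 comes from.
  nlinarith [sq_nonneg ((k : ℝ) - 9 / 2)]

/-- A completed stage costs at most 2 from the geometric series and one logarithm. In the current
stage the geometric part so far is at most `(1 / 2) ^ r`, and the logarithm is due once the critical
halving has passed. -/
lemma sum_exLoss_aux (m : ℕ) : ∑ i ∈ Finset.range m, exLoss i ≤
    (exStage m).1 * (2 + Real.log (2 * ((exStage m).1 + 3))) + (1 / 2) ^ (exStage m).2 +
      if (exStage m).2 < exCrit (exStage m).1 then Real.log (2 * ((exStage m).1 + 3)) else 0 := by
  induction m with
  | zero => simp [exStage, exCrit]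
  | succ m ih =>
    rw [Finset.sum_range_succ, exLoss, exStage]
    generalize exStage m = p at *
    obtain ⟨k, r⟩ := p
    simp only at ih ⊢
    have hl := log_stage_ge_one k
    have hmono : Real.log (2 * ((k : ℝ) + 3)) ≤ Real.log (2 * (((k + 1 : ℕ) : ℝ) + 3)) :=
      Real.log_le_log (by positivity) (by push_cast; linarith)
    by_cases h1 : r = 0
    · subst h1
      have hk : ¬ (k + 1 < exCrit (k + 1)) := by unfold exCrit; omega
      rw [if_pos rfl]
      simp only
      rw [if_neg hk]
      have hp : (0 : ℝ) < (1 / 2) ^ (k + 1) := by positivity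
      have h3 : ((k + 1 : ℕ) : ℝ) * (2 + Real.log (2 * ((k : ℝ) + 3))) ≤
          ((k + 1 : ℕ) : ℝ) * (2 + Real.log (2 * (((k + 1 : ℕ) : ℝ) + 3))) :=
        mul_le_mul_of_nonneg_left (by linarith) (by positivity)
      rw [show ((k + 1 : ℕ) : ℝ) * (2 + Real.log (2 * ((k : ℝ) + 3))) =
        k * (2 + Real.log (2 * ((k : ℝ) + 3))) + 2 + Real.log (2 * ((k : ℝ) + 3)) by
          push_cast; ring] at h3
      rw [pow_zero] at *
      have hcase : (if 0 < exCrit k then Real.log (2 * ((k : ℝ) + 3)) else 0) +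
          (if 0 = exCrit k then Real.log (2 * ((k : ℝ) + 3)) else 0) ≤
            Real.log (2 * ((k : ℝ) + 3)) := by
        split_ifs <;> first | omega | linarith
      linarith
    · rw [if_neg h1]
      simp only
      have hcase : (if r < exCrit k then Real.log (2 * ((k : ℝ) + 3)) else 0) +
          (if r = exCrit k then Real.log (2 * ((k : ℝ) + 3)) else 0) ≤
            if r - 1 < exCrit k then Real.log (2 * ((k : ℝ) + 3)) else 0 := by
        split_ifs <;> first | omega | linarith
      have hpow : (1 / 2 : ℝ) ^ (r - 1) = 2 * (1 / 2) ^ r := by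
        obtain ⟨r, rfl⟩ := Nat.exists_eq_succ_of_ne_zero h1
        rw [Nat.succ_sub_one, pow_succ]
        ring
      rw [hpow]
      linarith

lemma sum_exLoss_le (m : ℕ) : ∑ i ∈ Finset.range m, exLoss i ≤
    ((exStage m).1 + 1) * (2 + Real.log (2 * ((exStage m).1 + 3))) := by
  refine (sum_exLoss_aux m).trans ?_
  have h1 := log_stage_ge_one (exStage m).1
  have h2 : (1 / 2 : ℝ) ^ (exStage m).2 ≤ 1 := pow_le_one₀ (by norm_num) (by norm_num)
  split_ifs <;> nlinarith

lemma tendsto_avg_zero_of_le {u : ℕ → ℝ} (hu0 : ∀ m, 0 ≤ u m)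
    (hu : ∀ m, u m ≤ ((exStage m).1 + 1) * (2 + Real.log (2 * ((exStage m).1 + 3)))) :
    Tendsto (fun m : ℕ => (1 / (m : ℝ)) * u m) atTop (𝓝 0) := by
  -- At `x = 2 * (k + 3)` the denominator `x / 2 - 3` equals `k`. As `m` is at least `k (k + 1) /
  -- 2`, the average is bounded by `φ x`.
  set φ : ℝ → ℝ := fun x => 4 * (1 / (1 / 2 * x + -3)) + 2 * (Real.log x / (1 / 2 * x + -3))
  have hφ : Tendsto φ atTop (𝓝 0) := by
    have h0 := Real.tendsto_pow_log_div_mul_add_atTop (1 / 2) (-3) 0 (by norm_num)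
    have h1 := Real.tendsto_pow_log_div_mul_add_atTop (1 / 2) (-3) 1 (by norm_num)
    simp only [pow_zero, pow_one] at h0 h1
    have h := (h0.const_mul 4).add (h1.const_mul 2)
    simp only [mul_zero, add_zero] at h
    exact h
  have hx : Tendsto (fun m => 2 * (((exStage m).1 : ℝ) + 3)) atTop atTop :=
    (tendsto_atTop_add_const_right _ _
      (tendsto_natCast_atTop_atTop.comp tendsto_exStage)).const_mul_atTop two_pos
  refine squeeze_zero' (Eventually.of_forall fun m => mul_nonneg (by positivity) (hu0 m)) ?_
    (hφ.comp hx)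
  filter_upwards [tendsto_exStage.eventually_ge_atTop 1, eventually_ge_atTop 1] with m hk hm
  have h1 := exStage_spec m
  have h2 := exStage_snd_le m
  have h3 := hu m
  have h4 := log_stage_ge_one (exStage m).1
  simp only [φ, Function.comp]
  set k := (exStage m).1
  have hk' : (1 : ℝ) ≤ k := by exact_mod_cast hk
  have hm' : (1 : ℝ) ≤ m := by exact_mod_cast hm
  have h5 : (k : ℝ) * (k + 1) ≤ 2 * m := by
    have : k * (k + 1) ≤ 2 * m := by nlinarith
    exact_mod_cast this
  rw [show (1 / 2 * (2 * ((k : ℝ) + 3)) + -3) = k by ring, one_div_mul_eq_div,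
    div_le_iff₀ (by linarith)]
  refine h3.trans ?_
  rw [show 4 * (1 / (k : ℝ)) + 2 * (Real.log (2 * (k + 3)) / k) =
    2 * (2 + Real.log (2 * (k + 3))) / k by ring, div_mul_eq_mul_div, le_div_iff₀ (by linarith)]
  nlinarith

lemma tendsto_avg_exLoss :
    Tendsto (fun m : ℕ => (1 / (m : ℝ)) * ∑ i ∈ Finset.range m, exLoss i) atTop (𝓝 0) :=
  tendsto_avg_zero_of_le (fun _ => Finset.sum_nonneg fun i _ => exLoss_nonneg i) sum_exLoss_le

lemma tendsto_log_exKappa :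
    Tendsto (fun m : ℕ => (1 / (m : ℝ)) * Real.log (exKappa m)) atTop (𝓝 0) := by
  have h := tendsto_avg_zero_of_le (u := fun m => -Real.log (exKappa m)) (fun m => ?_) fun m => ?_
  · simpa using h.neg
  · rw [exKappa, Real.log_inv, neg_neg]
    linarith [log_stage_ge_one (exStage m).1]
  · rw [exKappa, Real.log_inv, neg_neg]
    have h1 := log_stage_ge_one (exStage m).1
    have h2 : (0 : ℝ) ≤ (exStage m).1 := Nat.cast_nonneg _
    nlinarith

end HomogeneousPerfect

/-! ### Condition (3) and the failure of (A) and (B) -/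

namespace HomogeneousPerfect

lemma exEta_zero (k : ℕ) : exEta k 0 = 0 := by simp [exEta]

lemma exEta_last (k : ℕ) : exEta k (2 ^ k) = 0 := by simp [exEta]

/-- Order 1 fits the general formula: its only gap has number `l_1 = 1`, and `1 - 2 δ_1 = (1 + exX
1) δ_1` because the pieces fill `[0, 1]`. -/
lemma exEta_eq {k l : ℕ} (hl : 1 ≤ l) (hlk : l < 2 ^ (k + 1)) :
    exEta (k + 1) l = (1 + if l = exL (k + 1) then exX (k + 1) else 0) * prodC exC (k + 1) := by
  rw [exEta, if_neg (by omega)]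
  split_ifs with h1 h2 h2
  · obtain rfl : k = 0 := by omega
    have h3 := prodC_eq 0
    rw [prodC_zero] at h3
    norm_num at h3 ⊢
    linarith
  · obtain rfl : k = 0 := by omega
    exact absurd (by rw [exL]; norm_num at hlk ⊢; omega) h2
  · unfold exX; ring
  · ring

lemma prodC_le_exEta {k l : ℕ} (hl : 1 ≤ l) (hlk : l < 2 ^ (k + 1)) :
    prodC exC (k + 1) ≤ exEta (k + 1) l := by
  rw [exEta_eq hl hlk]
  have h1 := prodC_pos (k + 1)
  have h2 := exX_pos (k + 1)
  split_ifs <;> nlinarith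

lemma exEta_exL (k : ℕ) :
    exEta (k + 1) (exL (k + 1)) = (1 + exX (k + 1)) * prodC exC (k + 1) := by
  rw [exEta_eq (exL_pos k) (exL_lt _), if_pos rfl]

lemma succ_le_exX (k : ℕ) : (k : ℝ) + 1 ≤ exX k := by
  have h : (1 : ℝ) ≤ Real.sqrt 2 ^ k := one_le_pow₀ (Real.one_le_sqrt.2 one_le_two)
  have h0 : (0 : ℝ) ≤ k := Nat.cast_nonneg k
  unfold exX
  nlinarith

lemma exEta_exL_le_maxGap (k : ℕ) :
    (1 + exX (k + 1)) * prodC exC (k + 1) ≤ maxGap exN exEta (k + 1) := by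
  rw [← exEta_exL]
  exact le_csSup ((Set.finite_Ico _ _).image _).bddAbove
    ⟨exL (k + 1), ⟨exL_pos k, exL_lt _⟩, rfl⟩

lemma condThree_example : CondThree exN exC exEta := by
  refine ⟨1 / 5, by norm_num, fun k hk => ?_⟩
  obtain ⟨k, rfl⟩ : ∃ i, k = i + 1 := ⟨k - 1, by omega⟩
  rw [Nat.add_sub_cancel, prodC_eq k]
  have hδ := prodC_pos (k + 1)
  have hmin : prodC exC (k + 1) ≤ minGap exN exEta (k + 1) := by
    refine le_csInf (Set.Nonempty.image _ ⟨1, le_rfl, ?_⟩) ?_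
    · exact Nat.one_lt_two_pow (Nat.succ_ne_zero k)
    · rintro _ ⟨l, ⟨h1, h2⟩, rfl⟩
      exact prodC_le_exEta h1 h2
  have hs2 : Real.sqrt 2 * Real.sqrt 2 = 2 := Real.mul_self_sqrt zero_le_two
  have hs : (7 / 5 : ℝ) ≤ Real.sqrt 2 := Real.le_sqrt_of_sq_le (by norm_num)
  -- Bernoulli with `√2 - 1 ≥ 2 / 5`. It bounds the excess by `1 + 5 / 2 * 2 ^ (k + 1)`, so the
  -- parent has at most `9 / 2 * 2 ^ (k + 1)` units, which the constant `1 / 5` covers.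
  have hbern : ((k + 1 : ℕ) : ℝ) ≤ 5 / 2 * Real.sqrt 2 ^ (k + 1) := by
    have h := one_add_mul_le_pow (a := Real.sqrt 2 - 1) (by linarith) (k + 1)
    rw [add_sub_cancel] at h
    have : (0 : ℝ) ≤ ((k + 1 : ℕ) : ℝ) := Nat.cast_nonneg _
    nlinarith
  have hX : exX (k + 1) ≤ 1 + 5 / 2 * 2 ^ (k + 1) := by
    have hp : (0 : ℝ) ≤ Real.sqrt 2 ^ (k + 1) := by positivity
    have : Real.sqrt 2 ^ (k + 1) * Real.sqrt 2 ^ (k + 1) = 2 ^ (k + 1) := by rw [← mul_pow, hs2]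
    unfold exX
    nlinarith
  rw [exN]
  push_cast
  have h2 : (0 : ℝ) < 2 ^ (k + 1) := by positivity
  calc 1 / 5 * ((2 * 2 ^ (k + 1) - 1 + exX (k + 1)) * prodC exC (k + 1))
      ≤ 2 ^ (k + 1) * prodC exC (k + 1) := by
        rw [← mul_assoc]
        exact mul_le_mul_of_nonneg_right (by linarith) hδ.le
    _ ≤ _ := mul_le_mul_of_nonneg_left hmin h2.le

lemma not_condA_example : ¬ CondA exN exEta := by
  rintro ⟨C, hC, h⟩
  obtain ⟨k, hk⟩ := exists_nat_gt C
  have h1 := h (k + 1 + 1) (by omega)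
  have h2 := exEta_exL_le_maxGap (k + 1)
  have h3 := succ_le_exX (k + 1 + 1)
  have hδ := prodC_pos (k + 1 + 1)
  -- The order is at least 2, so gap number 1 is an ordinary one and the ratio of maximum to minimum
  -- is at least `1 + exX`.
  have hlt : 1 < 2 ^ (k + 1 + 1) := Nat.one_lt_two_pow (by omega)
  have h4 : minGap exN exEta (k + 1 + 1) ≤ prodC exC (k + 1 + 1) := by
    have h5 := two_pow_le_exL (k + 1)
    have h6 : 1 < 2 ^ (k + 1) := Nat.one_lt_two_pow (by omega)
    have h7 : exEta (k + 1 + 1) 1 = prodC exC (k + 1 + 1) := by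
      rw [exEta_eq le_rfl hlt, if_neg (by omega), add_zero, one_mul]
    rw [← h7]
    exact csInf_le ((Set.finite_Ico _ _).image _).bddBelow ⟨1, ⟨le_rfl, hlt⟩, rfl⟩
  push_cast at h3
  nlinarith

lemma not_condB_example : ¬ CondB exN exC exEta := by
  rintro ⟨D, hD, h⟩
  obtain ⟨k, hk⟩ := exists_nat_gt D
  have h1 := (exEta_exL_le_maxGap k).trans (h (k + 1) (by omega))
  have h3 := succ_le_exX (k + 1)
  have h2 := le_of_mul_le_mul_right h1 (prodC_pos (k + 1))
  push_cast at h3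
  linarith

/-! ### Construction of a system -/

section Existence

/-- The left endpoint of the interval of a word; the word is read backwards. -/
noncomputable def revLo : List ℕ → ℝ
  | [] => 0
  | j :: l => revLo l + exPos (l.length + 1) (j - 1)

lemma revLo_append (σ : List ℕ) (j : ℕ) :
    revLo (σ ++ [j]).reverse = revLo σ.reverse + exPos (σ.length + 1) (j - 1) := by
  simp [revLo]

lemma length_of_mem_words {n : ℕ → ℕ} {k : ℕ} {σ : List ℕ} (h : σ ∈ Words n k) :
    σ.length = k := by
  induction k generalizing σ with
  | zero => rw [show σ = [] from h]; rfl
  | succ k ih =>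
    obtain ⟨τ, hτ, j, -, -, rfl⟩ := h
    simp [ih hτ]

lemma exPos_mono (k : ℕ) : Monotone (exPos k) := by
  refine monotone_nat_of_le_succ fun r => ?_
  rw [exPos_succ]
  have h1 := prodC_pos k
  have h2 := exX_pos k
  have : 0 ≤ (2 + if r + 1 = exL k then exX k else 0) * prodC exC k := by
    split_ifs <;> positivity
  linarith

lemma exC_lt_one (k : ℕ) (hk : 1 ≤ k) : exC k < 1 := by
  apply inv_lt_one_of_one_lt₀
  have h1 : (1 : ℝ) < 2 ^ (k + 1) := one_lt_pow₀ one_lt_two (by omega)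
  have h2 : (0 : ℝ) ≤ k * Real.sqrt 2 ^ k := by positivity
  linarith

/-- The collection of intervals of the example. -/
noncomputable def exSystem : System exN exC exEta where
  two_le_n k hk := by
    calc 2 = 2 ^ 1 := rfl
      _ ≤ 2 ^ k := Nat.pow_le_pow_right two_pos hk
  c_pos k _ := exC_pos k
  c_lt_one := exC_lt_one
  eta_nonneg k j hk hj := by
    obtain ⟨k, rfl⟩ : ∃ i, k = i + 1 := ⟨k - 1, by omega⟩
    rcases Nat.eq_zero_or_pos j with rfl | h0
    · exact (exEta_zero _).ge
    · rcases (show j ≤ 2 ^ (k + 1) from hj).eq_or_lt with rfl | h1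
      · exact (exEta_last _).ge
      · exact (prodC_pos _).le.trans (prodC_le_exEta h0 h1)
  lo σ := revLo σ.reverse
  hi σ := revLo σ.reverse + prodC exC σ.length
  lo_root := rfl
  hi_root := by simp [revLo, prodC]
  lo_le_hi k σ _ := le_add_of_nonneg_right (prodC_pos _).le
  subinterval k σ hσ i hi1 hi2 := by
    change i ≤ 2 ^ (k + 1) at hi2
    have h0 := exPos_mono (k + 1) (Nat.zero_le (i - 1))
    have h1 := exPos_mono (k + 1) (by omega : i - 1 ≤ 2 ^ (k + 1) - 1)
    have h2 := exPos_last k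
    rw [exPos_zero] at h0
    rw [revLo_append, List.length_append, List.length_singleton, length_of_mem_words hσ]
    exact Icc_subset_Icc (by linarith) (by linarith)
  ordered k σ hσ i hi1 hi2 := by
    rw [revLo_append, revLo_append, List.length_append, List.length_singleton,
      length_of_mem_words hσ, Nat.add_sub_cancel]
    have h := exPos_succ (k + 1) (i - 1)
    rw [Nat.sub_add_cancel hi1] at h
    rw [h]
    have h1 := prodC_pos (k + 1)
    have h2 := exX_pos (k + 1)
    split_ifs <;> nlinarith
  ratio k σ hσ i _ _ := by
    rw [List.length_append, List.length_singleton, length_of_mem_words hσ, add_sub_cancel_left,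
      add_sub_cancel_left, prodC_succ, mul_div_cancel_left₀ _ (prodC_pos k).ne']
  gap_left k σ hσ := by
    rw [revLo_append, length_of_mem_words hσ, Nat.sub_self, exPos_zero, exEta_zero]
    ring
  gap_right k σ hσ := by
    change _ = exEta (k + 1) (2 ^ (k + 1))
    rw [revLo_append, List.length_append, List.length_singleton, length_of_mem_words hσ,
      exEta_last, exN]
    have h2 := exPos_last k
    linarith
  gap_mid k σ hσ i hi1 hi2 := by
    rw [revLo_append, revLo_append, List.length_append, List.length_singleton,
      length_of_mem_words hσ, Nat.add_sub_cancel, exEta_eq hi1 hi2]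
    have h := exPos_succ (k + 1) (i - 1)
    rw [Nat.sub_add_cancel hi1] at h
    rw [h]
    ring

end Existence

/-! ### Numbering of generations, blocks and words -/

lemma mIndex_succ (k : ℕ) : mIndex exN (k + 1) = mIndex exN k + (k + 1) := by
  rw [mIndex, mIndex, Finset.sum_Icc_succ_top (by omega), numSteps, exN, Nat.log_pow one_lt_two]

lemma exStage_mIndex_add {k t : ℕ} (ht : t ≤ k) : exStage (mIndex exN k + t) = (k, k - t) := by
  induction k generalizing t with
  | zero =>
    obtain rfl : t = 0 := by omega
    simp [mIndex, exStage]
  | succ k ih =>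
    induction t with
    | zero =>
      rw [mIndex_succ, add_zero, ← add_assoc, exStage, ih le_rfl]
      simp
    | succ t iht =>
      rw [← add_assoc, exStage, iht (by omega), if_neg (by simp only; omega)]
      simp only [Prod.mk.injEq, true_and]
      omega

lemma exists_eq_mIndex_add (m : ℕ) : ∃ k t, t ≤ k ∧ m = mIndex exN k + t := by
  induction m with
  | zero => exact ⟨0, 0, le_rfl, by simp [mIndex]⟩
  | succ m ih =>
    obtain ⟨k, t, ht, rfl⟩ := ih
    rcases ht.eq_or_lt with rfl | h
    · exact ⟨t + 1, 0, by omega, by rw [mIndex_succ]; ring⟩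
    · exact ⟨k, t + 1, h, by ring⟩

/-- With `2 ^ K` children every halving is exact, so the blocks are the dyadic ones and the rounding
convention plays no role. -/
lemma mem_blocks {K t p q : ℕ} (ht : t ≤ K) : (p, q) ∈ blocks (2 ^ K) t ↔
    ∃ u < 2 ^ t, p = u * 2 ^ (K - t) ∧ q = (u + 1) * 2 ^ (K - t) := by
  induction t generalizing p q with
  | zero =>
    rw [blocks, mem_singleton_iff, Prod.mk.injEq]
    constructor
    · rintro ⟨rfl, rfl⟩
      exact ⟨0, by simp, by simp, by simp⟩
    · rintro ⟨u, hu, rfl, rfl⟩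
      obtain rfl : u = 0 := by simpa using hu
      simp
  | succ t ih =>
    have hpow : 2 ^ (K - t) = 2 * 2 ^ (K - (t + 1)) := by
      rw [← pow_succ']; congr 1; omega
    have hhalf : ∀ u, ((u + 1) * 2 ^ (K - t) - u * 2 ^ (K - t)) / 2 = 2 ^ (K - (t + 1)) := by
      intro u
      rw [add_mul, one_mul, Nat.add_sub_cancel_left, hpow, Nat.mul_div_cancel_left _ two_pos]
    have e1 : ∀ u, u * 2 ^ (K - t) = 2 * u * 2 ^ (K - (t + 1)) := fun u => by rw [hpow]; ring
    have hp : 2 ^ (t + 1) = 2 * 2 ^ t := pow_succ' 2 t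
    constructor
    · rintro ⟨p', q', h, h' | h'⟩ <;> obtain ⟨rfl, rfl⟩ := Prod.mk.inj h' <;>
        obtain ⟨u, hu, rfl, rfl⟩ := (ih (by omega)).1 h
      · refine ⟨2 * u, by omega, e1 u, ?_⟩
        rw [hhalf, e1]; ring
      · refine ⟨2 * u + 1, by omega, ?_, ?_⟩
        · rw [hhalf, e1]; ring
        · rw [e1]; ring
    · rintro ⟨u, hu, rfl, rfl⟩
      refine ⟨u / 2 * 2 ^ (K - t), (u / 2 + 1) * 2 ^ (K - t),
        (ih (by omega)).2 ⟨u / 2, by omega, rfl, rfl⟩, ?_⟩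
      rw [hhalf, e1, e1, Prod.mk.injEq, Prod.mk.injEq]
      rcases Nat.even_or_odd' u with ⟨v, rfl | rfl⟩
      · left
        rw [show 2 * v / 2 = v by omega]
        exact ⟨rfl, by ring⟩
      · right
        rw [show (2 * v + 1) / 2 = v by omega]
        exact ⟨by ring, by ring⟩

/-- The word of length `k` of the interval of number `i` (from left to right). -/
def word : ℕ → ℕ → List ℕ
  | 0, _ => []
  | k + 1, i => word k (i / 2 ^ (k + 1)) ++ [i % 2 ^ (k + 1) + 1]

lemma word_mem (k i : ℕ) : word k i ∈ Words exN k := by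
  induction k generalizing i with
  | zero => rfl
  | succ k ih =>
    exact ⟨_, ih _, _, Nat.le_add_left _ _, Nat.mod_lt _ (Nat.two_pow_pos _), rfl⟩

lemma mul_add_lt_mul {i a r b : ℕ} (hi : i < a) (hr : r < b) : i * b + r < a * b := by
  have : (i + 1) * b ≤ a * b := Nat.mul_le_mul_right _ hi
  rw [add_mul] at this
  omega

lemma exists_eq_word {k : ℕ} {σ : List ℕ} (h : σ ∈ Words exN k) :
    ∃ i < 2 ^ mIndex exN k, σ = word k i := by
  induction k generalizing σ with
  | zero => exact ⟨0, by positivity, h⟩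
  | succ k ih =>
    obtain ⟨τ, hτ, j, h1, h2, rfl⟩ := h
    obtain ⟨i, hi, rfl⟩ := ih hτ
    change j ≤ 2 ^ (k + 1) at h2
    refine ⟨i * 2 ^ (k + 1) + (j - 1), ?_, ?_⟩
    · rw [mIndex_succ, pow_add (2 : ℕ) (mIndex exN k)]
      exact mul_add_lt_mul hi (by omega)
    · rw [word, add_comm (i * _), Nat.add_mul_mod_self_right, Nat.mod_eq_of_lt (by omega),
        Nat.add_mul_div_right _ _ (by positivity), Nat.div_eq_of_lt (by omega), zero_add,
        Nat.sub_add_cancel h1]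

/-! ### Every system realises the tree -/

namespace System

variable (H : System exN exC exEta)

lemma hi_eq {k : ℕ} {σ : List ℕ} (h : σ ∈ Words exN k) : H.hi σ = H.lo σ + prodC exC k := by
  induction k generalizing σ with
  | zero =>
    rw [show σ = [] from h, H.lo_root, H.hi_root, prodC_zero, zero_add]
  | succ k ih =>
    obtain ⟨τ, hτ, j, h1, h2, rfl⟩ := h
    have h3 := H.ratio k τ hτ j h1 h2
    rw [ih hτ, add_sub_cancel_left, div_eq_iff (prodC_pos k).ne'] at h3
    rw [prodC_succ]
    linarith

/-- Lengths and gaps determine all endpoints, so any two systems have the same intervals. -/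
lemma lo_append {k r : ℕ} {σ : List ℕ} (h : σ ∈ Words exN k) (hr : r < 2 ^ (k + 1)) :
    H.lo (σ ++ [r + 1]) = H.lo σ + exPos (k + 1) r := by
  induction r with
  | zero =>
    have := H.gap_left k σ h
    rw [exEta_zero] at this
    rw [exPos_zero, zero_add]
    linarith
  | succ r ih =>
    have h1 := H.gap_mid k σ h (r + 1) (by omega) hr
    have h2 : σ ++ [r + 1] ∈ Words exN (k + 1) :=
      ⟨σ, h, r + 1, by omega, by change r + 1 ≤ 2 ^ (k + 1); omega, rfl⟩
    rw [H.hi_eq h2, ih (by omega), exEta_eq (by omega) hr] at h1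
    rw [exPos_succ]
    linarith

lemma lo_word (k i : ℕ) : H.lo (word k i) = exLo k i := by
  induction k generalizing i with
  | zero => exact H.lo_root
  | succ k ih =>
    rw [word, H.lo_append (word_mem _ _) (Nat.mod_lt _ (by positivity)), ih, exLo]

lemma starLo_eq (σ : List ℕ) : H.starLo σ = H.lo σ := by
  rw [starLo, exEta_zero, add_zero]

lemma starHi_eq (σ : List ℕ) : H.starHi σ = H.hi σ := by
  rw [starHi, exN, exEta_last, sub_zero]

lemma level_eq {k t : ℕ} (ht : t ≤ k) : H.level k t = {I | ∃ j < 2 ^ (mIndex exN k + t),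
    I = Icc (blockLo (k + 1) (k + 1 - t) j) (blockHi (k + 1) (k + 1 - t) j)} := by
  ext I
  cases t with
  | zero =>
    simp only [Nat.sub_zero, blockLo_top, blockHi_top, add_zero]
    constructor
    · rintro ⟨σ, hσ, rfl⟩
      obtain ⟨i, hi, rfl⟩ := exists_eq_word hσ
      exact ⟨i, hi, by rw [H.starLo_eq, H.starHi_eq, H.hi_eq hσ, H.lo_word]⟩
    · rintro ⟨i, hi, rfl⟩
      exact ⟨word k i, word_mem k i, by
        rw [H.starLo_eq, H.starHi_eq, H.hi_eq (word_mem k i), H.lo_word]⟩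
  | succ t =>
    set s := k + 1 - (t + 1)
    have hpow : 2 ^ (t + 1) * 2 ^ s = 2 ^ (k + 1) := by rw [← pow_add]; congr 1; omega
    have hs0 : 0 < 2 ^ s := by positivity
    -- Block `u` inside parent `i` becomes block `i * 2 ^ (t + 1) + u` in the numbering across all
    -- parents.
    have key : ∀ i u, u < 2 ^ (t + 1) →
        Icc (H.starLo (word k i ++ [u * 2 ^ s + 1])) (H.starHi (word k i ++ [(u + 1) * 2 ^ s])) =
          Icc (blockLo (k + 1) s (i * 2 ^ (t + 1) + u))
            (blockHi (k + 1) s (i * 2 ^ (t + 1) + u)) := by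
      intro i u hu
      have hu2 : (u + 1) * 2 ^ s ≤ 2 ^ (k + 1) := by
        rw [← hpow]; exact Nat.mul_le_mul_right _ hu
      have hu3 : (u + 1) * 2 ^ s = u * 2 ^ s + 2 ^ s := by ring
      have hmem : word k i ++ [(u + 1) * 2 ^ s] ∈ Words exN (k + 1) :=
        ⟨_, word_mem k i, _, by omega, hu2, rfl⟩
      have h1 := H.lo_append (word_mem k i) (r := u * 2 ^ s) (by omega)
      have h2 := H.lo_append (word_mem k i) (r := (u + 1) * 2 ^ s - 1) (by omega)
      rw [Nat.sub_add_cancel (by omega)] at h2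
      rw [H.starLo_eq, H.starHi_eq, H.hi_eq hmem, h1, h2, H.lo_word, blockLo, blockHi,
        show (i * 2 ^ (t + 1) + u) * 2 ^ s = i * 2 ^ (k + 1) + u * 2 ^ s by rw [← hpow]; ring,
        show (i * 2 ^ (t + 1) + u + 1) * 2 ^ s - 1 =
          i * 2 ^ (k + 1) + ((u + 1) * 2 ^ s - 1) by
            rw [show (i * 2 ^ (t + 1) + u + 1) * 2 ^ s = i * 2 ^ (k + 1) + (u + 1) * 2 ^ s by
              rw [← hpow]; ring]
            omega, exLo_add i (by omega), exLo_add i (by omega)]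
    constructor
    · rintro ⟨σ, hσ, p, q, hpq, rfl⟩
      obtain ⟨i, hi, rfl⟩ := exists_eq_word hσ
      obtain ⟨u, hu, rfl, rfl⟩ := (mem_blocks (by omega)).1 hpq
      refine ⟨i * 2 ^ (t + 1) + u, ?_, key i u hu⟩
      rw [pow_add (2 : ℕ) (mIndex exN k)]
      exact mul_add_lt_mul hi hu
    · rintro ⟨j, hj, rfl⟩
      have hu : j % 2 ^ (t + 1) < 2 ^ (t + 1) := Nat.mod_lt _ (by positivity)
      refine ⟨word k (j / 2 ^ (t + 1)), word_mem _ _, j % 2 ^ (t + 1) * 2 ^ s,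
        (j % 2 ^ (t + 1) + 1) * 2 ^ s, (mem_blocks (by omega)).2 ⟨_, hu, rfl, rfl⟩, ?_⟩
      rw [key _ _ hu, Nat.div_add_mod']

lemma basic_eq (m : ℕ) : H.basic m = exTree.family m := by
  have key : ∀ k t, t ≤ k → H.level k t = exTree.family (mIndex exN k + t) := by
    intro k t ht
    rw [H.level_eq ht, IntervalTree.family]
    change _ = {I | ∃ j < _, I = Icc
      (blockLo ((exStage (mIndex exN k + t)).1 + 1) ((exStage (mIndex exN k + t)).2 + 1) j)
      (blockHi ((exStage (mIndex exN k + t)).1 + 1) ((exStage (mIndex exN k + t)).2 + 1) j)}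
    rw [exStage_mIndex_add ht, show k + 1 - t = k - t + 1 by omega]
  have hsteps : ∀ k, numSteps exN (k + 1) = k + 1 := fun k => by
    rw [numSteps, exN, Nat.log_pow one_lt_two]
  ext I
  constructor
  · rintro ⟨k, t, rfl, ht, hI⟩
    rw [hsteps] at ht
    rwa [← key k t (by omega)]
  · intro hI
    obtain ⟨k, t, ht, rfl⟩ := exists_eq_mIndex_add m
    exact ⟨k, t, rfl, by rw [hsteps]; omega, by rwa [key k t ht]⟩

lemma iInter_F_eq : ⋂ m, H.F m = exTree.limitSet :=
  iInter_congr fun m => F_eq_level H.basic_eq m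

lemma F_mIndex (k : ℕ) : H.F (mIndex exN k) = ⋃ σ ∈ Words exN k, Icc (H.lo σ) (H.hi σ) := by
  have h : H.basic (mIndex exN k) = H.level k 0 := by
    rw [H.basic_eq, H.level_eq (Nat.zero_le k), IntervalTree.family]
    change {I | ∃ j < _, I = Icc
      (blockLo ((exStage (mIndex exN k + 0)).1 + 1) ((exStage (mIndex exN k + 0)).2 + 1) j)
      (blockHi ((exStage (mIndex exN k + 0)).1 + 1) ((exStage (mIndex exN k + 0)).2 + 1) j)} = _
    rw [exStage_mIndex_add (Nat.zero_le k)]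
    rfl
  rw [F, h]
  ext x
  simp only [mem_sUnion, mem_iUnion, level, mem_ofPred_eq, starLo_eq, starHi_eq]
  constructor
  · rintro ⟨_, ⟨σ, hσ, rfl⟩, hx⟩
    exact ⟨σ, hσ, hx⟩
  · rintro ⟨σ, hσ, hx⟩
    exact ⟨_, ⟨σ, hσ, rfl⟩, hx⟩

lemma le_mIndex (k : ℕ) : k ≤ mIndex exN k := by
  cases k with
  | zero => exact Nat.zero_le _
  | succ k => rw [mIndex_succ]; omega

/-- The unions defining `E` are the `F` of index `m_k`; as `F` is decreasing, this subsequence has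
the same intersection. -/
lemma E_eq_iInter_F : H.E = ⋂ m, H.F m := by
  have hanti : Antitone H.F := fun a b hab => by
    rw [F_eq_level H.basic_eq, F_eq_level H.basic_eq]
    exact exTree.level_antitone hab
  apply Subset.antisymm
  · intro x hx
    refine mem_iInter.2 fun m => hanti (le_mIndex m) ?_
    rw [H.F_mIndex]
    exact mem_iInter.1 hx m
  · intro x hx
    refine mem_iInter.2 fun k => ?_
    rw [← H.F_mIndex]
    exact mem_iInter.1 hx _

/-! ### Failure of (c), the averaged conditions and minimality -/

lemma not_condC_example : ¬ H.CondC := by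
  rintro ⟨K, hK, h⟩
  obtain ⟨r, hr⟩ := exists_nat_gt K
  have hr0 : 1 < r := by
    have : (1 : ℝ) < r := by linarith
    exact_mod_cast this
  -- Blocks of `2 ^ r` intervals of order `2 * r`: gap `l = 2 ^ (2 * r) - 2 ^ (r - 1)` lies strictly
  -- inside the last block of its parent and not in the first. The two lengths have a ratio above
  -- `r`.
  have hst := exStage_mIndex_add (k := 2 * r - 1) (t := r) (by omega)
  have hm : r ≤ mIndex exN (2 * r - 1) + r := by omega
  set m := mIndex exN (2 * r - 1) + r
  have h1 := h m (by omega)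
  rw [volume_image_basic H.basic_eq] at h1
  have hfin := (Set.finite_Iio (2 ^ m)).image (exTree.len m)
  have hpr : 0 < 2 ^ r := by positivity
  have hlast : 2 ^ r - 1 < 2 ^ m := by
    have := Nat.pow_le_pow_right (n := 2) two_pos hm
    omega
  have h2 := le_csSup hfin.bddAbove ⟨2 ^ r - 1, hlast, rfl⟩
  have h3 := csInf_le hfin.bddBelow ⟨0, by simp, rfl⟩
  have h4 : exTree.len m (2 ^ r - 1) ≤ K * exTree.len m 0 :=
    h2.trans (h1.trans (mul_le_mul_of_nonneg_left h3 (by linarith)))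
  have hδ := prodC_pos (2 * r - 1 + 1)
  have hL := exL_add (k := 2 * r - 1 + 1)
  have hpe : 2 ^ (2 * r - 1 + 1) = 2 ^ r * 2 ^ r := by rw [← pow_add]; congr 1; omega
  have hpe2 : 2 * 2 ^ (2 * r - 1 + 1 - (2 * r - 1 + 1) / 2 - 1) = 2 ^ r := by
    rw [← pow_succ']; congr 1; omega
  have hge : 2 ^ r * 2 ≤ 2 ^ r * 2 ^ r := Nat.mul_le_mul_left _ (by omega)
  have l0 : exTree.len m 0 = (2 * 2 ^ r - 1) * prodC exC (2 * r - 1 + 1) := by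
    rw [exTree_len, hst]
    simp only
    rw [show 2 * r - 1 - r + 1 = r by omega, block_len (by omega), if_neg, add_zero]
    rw [Nat.zero_mod]
    omega
  have l1 : exTree.len m (2 ^ r - 1) =
      (2 * 2 ^ r - 1 + exX (2 * r - 1 + 1)) * prodC exC (2 * r - 1 + 1) := by
    rw [exTree_len, hst]
    simp only
    rw [show 2 * r - 1 - r + 1 = r by omega, block_len (by omega),
      show 2 * r - 1 + 1 - r = r by omega, Nat.mod_eq_of_lt (by omega), Nat.sub_add_cancel hpr,
      if_pos]
    rw [Nat.sub_mul, one_mul]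
    omega
  rw [l0, l1, ← mul_assoc] at h4
  have h5 := le_of_mul_le_mul_right h4 hδ
  have hX : exX (2 * r - 1 + 1) = 1 + 2 * r * 2 ^ r := by
    rw [exX, show 2 * r - 1 + 1 = 2 * r by omega, pow_mul, Real.sq_sqrt zero_le_two]
    push_cast
    ring
  rw [hX] at h5
  have hp : (0 : ℝ) < 2 ^ r := by positivity
  nlinarith

lemma condATilde_example : H.CondATilde := by
  refine squeeze_zero (fun m => ?_) (fun m => ?_) tendsto_avg_exLoss
  · exact mul_nonneg (by positivity) (Finset.sum_nonneg fun i _ => beta_nonneg H.basic_eq i)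
  · exact mul_le_mul_of_nonneg_left (Finset.sum_le_sum fun i _ =>
      beta_le H.basic_eq (exTree_gap_le i)) (by positivity)

lemma condBTilde_example : H.CondBTilde := by
  have hlow : ∀ i, Real.exp (-exLoss i) ≤ H.bigGamma i := fun i =>
    le_bigGamma H.basic_eq (exTree_gap_le_one_sub i)
  have hpos : ∀ i, 0 < H.bigGamma i := fun i => (Real.exp_pos _).trans_le (hlow i)
  have h := tendsto_avg_exLoss.neg
  rw [neg_zero] at h
  refine tendsto_of_tendsto_of_tendsto_of_le_of_le h tendsto_const_nhds (fun m => ?_) fun m => ?_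
  · simp only
    rw [← mul_neg, ← Finset.sum_neg_distrib]
    refine mul_le_mul_of_nonneg_left (Finset.sum_le_sum fun i _ => ?_) (by positivity)
    exact (Real.le_log_iff_exp_le (hpos i)).2 (hlow i)
  · exact mul_nonpos_of_nonneg_of_nonpos (by positivity) (Finset.sum_nonpos fun i _ =>
      Real.log_nonpos (hpos i).le (bigGamma_le_one H.basic_eq i))

lemma condCTilde_example : H.CondCTilde := by
  refine ⟨3 / 4, by norm_num, by norm_num, ?_⟩
  have hle : ∀ m : ℕ, 1 / 4 * (m : ℝ) - 3 ≤
      (({i : ℕ | 1 ≤ i ∧ i ≤ m ∧ H.smallGamma i < 3 / 4}.ncard : ℝ)) := by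
    intro m
    refine (card_exRatio_ge m).trans (Nat.cast_le.2 ?_)
    -- Index shift: the ratio at generation `j` bounds `γ` at `j + 1`.
    rw [← Finset.card_map ⟨Nat.succ, Nat.succ_injective⟩, ← Set.ncard_coe_finset]
    refine Set.ncard_le_ncard ?_ ((Set.finite_Icc 1 m).subset fun i hi => ⟨hi.1, hi.2.1⟩)
    intro i hi
    simp only [Finset.coe_map, Function.Embedding.coeFn_mk, mem_image, Finset.mem_coe,
      Finset.mem_filter, Finset.mem_range] at hi
    obtain ⟨j, ⟨hj, hr⟩, rfl⟩ := hi
    refine ⟨Nat.succ_pos j, hj, ?_⟩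
    have := smallGamma_succ_le H.basic_eq (exTree_len_succ_le ((exRatio_le_iff j).1 hr))
    exact this.trans_lt (by norm_num)
  have hle1 : ∀ m : ℕ,
      ({i : ℕ | 1 ≤ i ∧ i ≤ m ∧ H.smallGamma i < 3 / 4}.ncard : ℝ) / (m : ℝ) ≤ 1 := by
    intro m
    refine div_le_one_of_le₀ (Nat.cast_le.2 ?_) (Nat.cast_nonneg m)
    calc _ ≤ (Set.Icc 1 m).ncard :=
          Set.ncard_le_ncard (fun i hi => ⟨hi.1, hi.2.1⟩) (Set.finite_Icc 1 m)
      _ = m := by rw [← Finset.coe_Icc, Set.ncard_coe_finset, Nat.card_Icc, Nat.add_sub_cancel]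
  -- The density is at least `1 / 4 - 3 / m`, hence `1 / 8` from `m = 24` on. A real `liminf` also
  -- needs the upper bound `hle1` to be meaningful.
  refine lt_of_lt_of_le (by norm_num : (0 : ℝ) < 1 / 8) (le_liminf_of_le ?_ ?_)
  · exact (isBoundedUnder_of ⟨1, hle1⟩).isCoboundedUnder_ge
  · filter_upwards [eventually_ge_atTop 24] with m hm
    have hm' : (24 : ℝ) ≤ m := by exact_mod_cast hm
    rw [le_div_iff₀ (by linarith)]
    linarith [hle m]

lemma isQuasisymmetricallyMinimal_example : IsQuasisymmetricallyMinimal H.E := by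
  rw [H.E_eq_iInter_F, H.iInter_F_eq]
  have key : ∀ g : ℝ ≃ₜ ℝ, IsQuasisymmetric g → StrictMono g →
      1 ≤ dimH (g '' exTree.limitSet) := by
    intro g hg hmono
    have hlo : ∀ j, exTree.lo 0 j = 0 := fun j => blockLo_top 0 j
    have hhi : ∀ j, exTree.hi 0 j = 1 := fun j => by
      change blockHi 1 1 j = 1
      rw [blockHi_top, prodC_zero, exLo, zero_add]
    refine exTree.one_le_dimH_image_limitSet hg hmono (fun j => by rw [hlo, hlo])
      (fun j => by rw [hhi, hhi]) exTree_gap_le tendsto_avg_exLoss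
      (fun m => Real.exp_pos (-exLoss m)) exTree_gap_le_one_sub ?_ exKappa_pos exKappa_mul_len_le
      tendsto_log_exKappa (by norm_num : (1 / 2 : ℝ) < 1) (by norm_num : (0 : ℝ) < 1 / 4)
      exTree_len_succ_le_exRatio card_exRatio_ge
    simp only [Real.log_exp, Finset.sum_neg_distrib, mul_neg]
    simpa only [neg_zero] using tendsto_avg_exLoss.neg
  intro f hf
  -- Subsets of the line have dimension at most one, so it suffices that every image has dimension
  -- at least one.
  have h1 : dimH exTree.limitSet ≤ 1 := (dimH_mono (subset_univ _)).trans Real.dimH_univ.le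
  refine h1.trans ?_
  rcases f.continuous.strictMono_of_inj f.injective with h | h
  · exact key f hf h
  -- Negation is an isometry: it makes a decreasing `f` increasing without changing the control
  -- function or the dimension.
  · have h2 := key (f.trans (Homeomorph.neg ℝ)) (by
      obtain ⟨η, hη⟩ := hf
      refine ⟨η, fun a b x hab hxa hxb => ?_⟩
      simpa [nndist_neg_neg] using hη a b x hab hxa hxb) (fun x y hxy => neg_lt_neg (h hxy))
    have h3 : (f.trans (Homeomorph.neg ℝ)) '' exTree.limitSet =
        (fun x : ℝ => -x) '' (f '' exTree.limitSet) := by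
      rw [image_image]; rfl
    have hneg : Isometry fun x : ℝ => -x := (IsometryEquiv.neg ℝ).isometry
    rwa [h3, hneg.dimH_image] at h2

end System

end HomogeneousPerfect

theorem mainTheorem4 :
    Nonempty (HomogeneousPerfect.System HomogeneousPerfect.exN HomogeneousPerfect.exC
      HomogeneousPerfect.exEta) ∧
    HomogeneousPerfect.CondThree HomogeneousPerfect.exN HomogeneousPerfect.exC
      HomogeneousPerfect.exEta ∧
    ¬ HomogeneousPerfect.CondA HomogeneousPerfect.exN HomogeneousPerfect.exEta ∧
    ¬ HomogeneousPerfect.CondB HomogeneousPerfect.exN HomogeneousPerfect.exC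
      HomogeneousPerfect.exEta ∧
    ∀ H : HomogeneousPerfect.System HomogeneousPerfect.exN HomogeneousPerfect.exC
      HomogeneousPerfect.exEta,
      H.E = (⋂ m : ℕ, H.F m) ∧
      ¬ H.CondC ∧
      H.CondATilde ∧
      H.CondBTilde ∧
      H.CondCTilde ∧
      IsQuasisymmetricallyMinimal H.E :=
  ⟨⟨HomogeneousPerfect.exSystem⟩, HomogeneousPerfect.condThree_example,
    HomogeneousPerfect.not_condA_example, HomogeneousPerfect.not_condB_example,
    fun H => ⟨H.E_eq_iInter_F, H.not_condC_example, H.condATilde_example, H.condBTilde_example,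
      H.condCTilde_example, H.isQuasisymmetricallyMinimal_example⟩⟩
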